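/- Let $k$ be a field, let $G$ be an affine group scheme over $k$ with coordinate Hopf algebra $\mathcal{O}(G)$, and let $\mathsf{C}=\mathsf{Rep}\,G$ be the tensor category of finite-dimensional representations of $G$, so that $\mathrm{Ind}\,\mathsf{C}$ is the category of all $\mathcal{O}(G)$-comodules. Let $\mathsf{Alg}\,\mathsf{C}$ be the category of commutative algebras in $\mathrm{Ind}\,\mathsf{C}$ (commutative $k$-algebras $A$ with a coaction $A\to\mathcal{O}(G)\otimes_k A$ that is an algebra morphism) and $\mathsf{Aff}\,\mathsf{C}=(\mathsf{Alg}\,\mathsf{C})^{\mathrm{op}}$. For $A\in\mathsf{Alg}\,\mathsf{C}$ let $\mathsf{Mod}_{\mathsf{C}}A$ be the category of $A$-modules in $\mathrm{Ind}\,\mathsf{C}$; a morphism $A\to B$ in $\mathsf{Alg}\,\mathsf{C}$ is faithfully flat if the functor $B\otimes_A-:\mathsf{Mod}_{\mathsf{C}}A\to\mathsf{Mod}_{\mathsf{C}}B$ is exact and faithful. A presheaf of sets $F$ on $\mathsf{Aff}\,\mathsf{C}$, i.e. a functor $\mathsf{Alg}\,\mathsf{C}\to\mathsf{Set}$, is an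 (fpqc) faisceau if it satisfies the sheaf condition for every finite family $\{A\to B_i\}_{i\in I}$ of morphisms in $\mathsf{Alg}\,\mathsf{C}$ for which $A\to\prod_{i} B_i$ is faithfully flat. Write $\mathsf{Fun}\,\mathsf{C}$ for the category of presheaves of sets on $\mathsf{Aff}\,\mathsf{C}$ and $\mathsf{Fais}\,\mathsf{C}\subset\mathsf{Fun}\,\mathsf{C}$ for the full subcategory of faisceaux. Let $\mathsf{Sch}_k^G$ be the category of $k$-schemes $X$ equipped with a $G$-action $G\times X\to X$, with $G$-equivariant morphisms of $k$-schemes. For $A\in\mathsf{Alg}\,\mathsf{C}$ let $\underline{\mathrm{Spec}}\,A\in\mathsf{Sch}_k^G$ be the affine $k$-scheme of the underlying $k$-algebra of $A$, with the $G$-action given by the coaction of $A$. Then for every $X\in\mathsf{Sch}_k^G$ the functor $$H_X:=\mathrm{Hom}_G(\underline{\mathrm{Spec}}(-),X):\ \mathsf{Alg}\,\mathsf{C}\to\mathsf{Set}$$ is a faisceau, and the functor $\mathsf{Sch}_k^G\to\mathsf{Fun}\,\mathsf{C}$, $X\mapsto H_X$, is fully faithful. Thus $\mathsf{Sch}_k^G$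 embeds fully faithfully into $\mathsf{Fais}\,\mathsf{C}$. -/

import Mathlib

open AlgebraicGeometry CategoryTheory

universe u

namespace EquivGeom

noncomputable section

open MonoidalCategory Opposite TensorProduct MonObj

/-- Throughout `k` is the base ring (to be thought of as a field) and `H = O(G)` the coordinate Hopf
algebra of an affine group scheme `G` over `k`. The ind-completion of the tensor category
`C = Rep G` of finite-dimensional representations is the category of all representations of `G`,
that is, of all (left) `O(G)`-comodules, with the tensor product over `k`. A commutative algebra in
`Ind C` is therefore a commutative `k`-algebra `A` together with a comodule structure
`A → O(G) ⊗ A` which is a homomorphism of algebras (equivalently: for which unit and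
multiplication of `A` are comodule maps). -/
structure ComodAlg (k : CommRingCat.{u}) (H : Type u) [CommRing H] [HopfAlgebra k H] where
  carrier : Type u
  [commRing : CommRing carrier]
  [algebra : Algebra k carrier]
  coact : carrier →ₐ[k] H ⊗[k] carrier
  counit_coact :
    (Algebra.TensorProduct.lid k carrier : k ⊗[k] carrier →ₐ[k] carrier).comp
      ((Algebra.TensorProduct.map (Bialgebra.counitAlgHom k H) (AlgHom.id k carrier)).comp coact) =
      AlgHom.id k carrier
  coassoc :
    (Algebra.TensorProduct.assoc k k k H H carrier :
        (H ⊗[k] H) ⊗[k] carrier →ₐ[k] H ⊗[k] (H ⊗[k] carrier)).comp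
      ((Algebra.TensorProduct.map (Bialgebra.comulAlgHom k H) (AlgHom.id k carrier)).comp coact) =
      (Algebra.TensorProduct.map (AlgHom.id k H) coact).comp coact

attribute [instance] ComodAlg.commRing ComodAlg.algebra

section
variable {k : CommRingCat.{u}} {H : Type u} [CommRing H] [HopfAlgebra k H]

namespace ComodAlg

/-- Morphisms in `Alg C`: algebra homomorphisms that are comodule maps. -/
@[ext]
structure Hom (A B : ComodAlg k H) where
  toAlgHom : A.carrier →ₐ[k] B.carrier
  comm : (Algebra.TensorProduct.map (AlgHom.id k H) toAlgHom).comp A.coact =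
    B.coact.comp toAlgHom

instance : Category (ComodAlg k H) where
  Hom := Hom
  id A := ⟨AlgHom.id k A.carrier, by simp⟩
  comp {A B C} f g := ⟨g.toAlgHom.comp f.toAlgHom, by
    rw [← AlgHom.comp_assoc, ← g.comm, AlgHom.comp_assoc, ← f.comm, ← AlgHom.comp_assoc,
      ← Algebra.TensorProduct.map_id_comp]⟩

/-- The forgetful functor `ω : Alg C ⥤ Alg k`. -/
def forget (k : CommRingCat.{u}) (H : Type u) [CommRing H] [HopfAlgebra k H] :
    ComodAlg k H ⥤ CommAlgCat.{u} k where
  obj A := CommAlgCat.of k A.carrier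
  map f := CommAlgCat.ofHom f.toAlgHom

section Pi
variable {J : Type} [Fintype J] [DecidableEq J] (B : J → ComodAlg k H)

/-- The coaction on a finite product `∏ B i`: the product of the coactions of the `B i`, followed
by the inverse of `H ⊗ ∏ B i ≃ ∏ (H ⊗ B i)`. -/
def piCoact : (∀ i, (B i).carrier) →ₐ[k] H ⊗[k] (∀ i, (B i).carrier) :=
  (Algebra.TensorProduct.piRight k k H (fun i => (B i).carrier)).symm.toAlgHom.comp
    (AlgHom.pi fun i => (B i).coact.comp (Pi.evalAlgHom k (fun i => (B i).carrier) i))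

lemma map_eval_eq (i : J) (x : H ⊗[k] (∀ i, (B i).carrier)) :
    Algebra.TensorProduct.map (AlgHom.id k H) (Pi.evalAlgHom k (fun i => (B i).carrier) i) x =
      Algebra.TensorProduct.piRight k k H (fun i => (B i).carrier) x i := by
  induction x with
  | zero => simp
  | tmul h b => simp
  | add x y hx hy => rw [map_add, map_add, hx, hy]; rfl

lemma map_eval_piCoact (i : J) (x : ∀ i, (B i).carrier) :
    Algebra.TensorProduct.map (AlgHom.id k H) (Pi.evalAlgHom k (fun i => (B i).carrier) i)
      (piCoact B x) = (B i).coact (x i) := by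
  rw [map_eval_eq]
  simp [piCoact]

lemma tensor_pi_ext {x y : H ⊗[k] (∀ i, (B i).carrier)}
    (h : ∀ i, Algebra.TensorProduct.map (AlgHom.id k H)
        (Pi.evalAlgHom k (fun i => (B i).carrier) i) x =
      Algebra.TensorProduct.map (AlgHom.id k H)
        (Pi.evalAlgHom k (fun i => (B i).carrier) i) y) : x = y := by
  apply (Algebra.TensorProduct.piRight k k H (fun i => (B i).carrier)).injective
  funext i
  rw [← map_eval_eq, ← map_eval_eq, h]

lemma tensor_tensor_pi_ext {x y : H ⊗[k] (H ⊗[k] (∀ i, (B i).carrier))}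
    (h : ∀ i, Algebra.TensorProduct.map (AlgHom.id k H)
        (Algebra.TensorProduct.map (AlgHom.id k H)
          (Pi.evalAlgHom k (fun i => (B i).carrier) i)) x =
      Algebra.TensorProduct.map (AlgHom.id k H)
        (Algebra.TensorProduct.map (AlgHom.id k H)
          (Pi.evalAlgHom k (fun i => (B i).carrier) i)) y) : x = y := by
  apply (Algebra.TensorProduct.assoc k k k H H (∀ i, (B i).carrier)).symm.injective
  apply (Algebra.TensorProduct.piRight k k (H ⊗[k] H) (fun i => (B i).carrier)).injective
  funext i
  have key : ∀ z : H ⊗[k] (H ⊗[k] (∀ i, (B i).carrier)),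
      Algebra.TensorProduct.piRight k k (H ⊗[k] H) (fun i => (B i).carrier)
        ((Algebra.TensorProduct.assoc k k k H H (∀ i, (B i).carrier)).symm z) i =
      (Algebra.TensorProduct.assoc k k k H H (B i).carrier).symm
        (Algebra.TensorProduct.map (AlgHom.id k H)
        (Algebra.TensorProduct.map (AlgHom.id k H)
          (Pi.evalAlgHom k (fun i => (B i).carrier) i)) z) := by
    intro z
    induction z with
    | zero => simp
    | tmul h w =>
      induction w with
      | zero => simp
      | tmul h' b => simp
      | add x y hx hy => rw [tmul_add, map_add, map_add, map_add, map_add, Pi.add_apply, hx, hy]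
    | add x y hx hy => rw [map_add, map_add, map_add, map_add, Pi.add_apply, hx, hy]
  rw [key, key, h]

/-- The product in `Alg C` of a finite family of algebras. -/
def pi : ComodAlg k H where
  carrier := ∀ i, (B i).carrier
  coact := piCoact B
  counit_coact := by
    refine AlgHom.ext fun x => funext fun i => ?_
    have h1 := DFunLike.congr_fun (B i).counit_coact (x i)
    simp only [AlgHom.comp_apply] at h1 ⊢
    rw [← map_eval_piCoact] at h1
    refine Eq.trans ?_ h1
    generalize piCoact B x = z
    induction z with
    | zero => simp
    | tmul h b => simp
    | add x y hx hy => simp only [map_add, Pi.add_apply, hx, hy]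
  coassoc := by
    refine AlgHom.ext fun x => tensor_tensor_pi_ext B fun i => ?_
    have h1 := DFunLike.congr_fun (B i).coassoc (x i)
    simp only [AlgHom.comp_apply] at h1 ⊢
    rw [← map_eval_piCoact] at h1
    have e1 : ∀ z : H ⊗[k] (∀ i, (B i).carrier), Algebra.TensorProduct.map (AlgHom.id k H)
        (Algebra.TensorProduct.map (AlgHom.id k H)
          (Pi.evalAlgHom k (fun i => (B i).carrier) i))
        (Algebra.TensorProduct.map (AlgHom.id k H) (piCoact B) z) =
        Algebra.TensorProduct.map (AlgHom.id k H) (B i).coact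
          (Algebra.TensorProduct.map (AlgHom.id k H)
            (Pi.evalAlgHom k (fun i => (B i).carrier) i) z) := by
      intro z
      induction z with
      | zero => simp
      | tmul h b => simp [map_eval_piCoact]
      | add x y hx hy => simp only [map_add, hx, hy]
    have e2 : ∀ z : (H ⊗[k] H) ⊗[k] (∀ i, (B i).carrier), Algebra.TensorProduct.map (AlgHom.id k H)
        (Algebra.TensorProduct.map (AlgHom.id k H)
          (Pi.evalAlgHom k (fun i => (B i).carrier) i))
        (Algebra.TensorProduct.assoc k k k H H (∀ i, (B i).carrier) z) =
        Algebra.TensorProduct.assoc k k k H H (B i).carrier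
          (Algebra.TensorProduct.map (AlgHom.id k (H ⊗[k] H))
            (Pi.evalAlgHom k (fun i => (B i).carrier) i) z) := by
      intro z
      induction z with
      | zero => simp
      | tmul h b =>
        induction h with
        | zero => simp
        | tmul h h' => simp
        | add x y hx hy => rw [add_tmul]; simp only [map_add, hx, hy]
      | add x y hx hy => simp only [map_add, hx, hy]
    have e3 : ∀ z : H ⊗[k] (∀ i, (B i).carrier),
        Algebra.TensorProduct.map (AlgHom.id k (H ⊗[k] H))
            (Pi.evalAlgHom k (fun i => (B i).carrier) i)
          (Algebra.TensorProduct.map (Bialgebra.comulAlgHom k H) (AlgHom.id k _) z) =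
        Algebra.TensorProduct.map (Bialgebra.comulAlgHom k H) (AlgHom.id k _)
          (Algebra.TensorProduct.map (AlgHom.id k H)
            (Pi.evalAlgHom k (fun i => (B i).carrier) i) z) := by
      intro z
      induction z with
      | zero => simp
      | tmul h b => simp
      | add x y hx hy => simp only [map_add, hx, hy]
    refine Eq.trans ?_ (h1.trans ?_)
    · refine (e2 _).trans ?_
      rw [e3]; rfl
    · exact (e1 _).symm

/-- The morphism `A ⟶ ∏ B i` in `Alg C` with components `f i : A ⟶ B i`. -/
def piLift {A : ComodAlg k H} (f : ∀ i, A ⟶ B i) : A ⟶ pi B where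
  toAlgHom := AlgHom.pi fun i => (f i).toAlgHom
  comm := by
    refine AlgHom.ext fun x => tensor_pi_ext B fun i => ?_
    have h1 := DFunLike.congr_fun (f i).comm x
    refine Eq.trans ?_ (h1.trans (map_eval_piCoact B i fun j => (f j).toAlgHom x).symm)
    have e : ∀ z : H ⊗[k] A.carrier,
        Algebra.TensorProduct.map (AlgHom.id k H) (Pi.evalAlgHom k (fun i => (B i).carrier) i)
          (Algebra.TensorProduct.map (AlgHom.id k H) (AlgHom.pi fun i => (f i).toAlgHom) z) =
        Algebra.TensorProduct.map (AlgHom.id k H) (f i).toAlgHom z := by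
      intro z
      induction z with
      | zero => simp
      | tmul h b => simp
      | add x y hx hy => simp only [map_add, hx, hy]
    exact e _

end Pi

end ComodAlg

/-- The objects of `Mod_C A`: modules in `Ind C` over the algebra `A` in `Ind C`, i.e. `A`-modules
with a comodule structure for which the action `A ⊗ M → M` is a comodule map:
`coact (a • m)` is the product of `coact a` and `coact m` under
`(h ⊗ b) · (h' ⊗ m') = h h' ⊗ b • m'`. -/
structure EquivModule (A : ComodAlg k H) where
  carrier : Type u
  [addCommGroup : AddCommGroup carrier]
  [baseModule : Module k carrier]
  [module : Module A.carrier carrier]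
  [isScalarTower : IsScalarTower k A.carrier carrier]
  coact : carrier →ₗ[k] H ⊗[k] carrier
  counit_coact :
    (TensorProduct.lid k carrier).toLinearMap ∘ₗ
      LinearMap.rTensor carrier (Coalgebra.counit (R := k) (A := H)) ∘ₗ coact = LinearMap.id
  coassoc :
    (TensorProduct.assoc k H H carrier).toLinearMap ∘ₗ
      LinearMap.rTensor carrier (Coalgebra.comul (R := k) (A := H)) ∘ₗ coact =
      LinearMap.lTensor H coact ∘ₗ coact
  coact_smul : ∀ (a : A.carrier) (m : carrier),
    coact (a • m) =
      TensorProduct.map₂ (LinearMap.mul k H)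
        (Algebra.lsmul k k carrier : A.carrier →ₐ[k] Module.End k carrier).toLinearMap
        (A.coact a) (coact m)

attribute [instance] EquivModule.addCommGroup EquivModule.baseModule EquivModule.module
  EquivModule.isScalarTower

/-- The morphisms of `Mod_C A`: the `A`-linear maps that are comodule maps. -/
def EquivModule.IsEquivariant {A : ComodAlg k H} {M N : EquivModule A}
    (f : M.carrier →ₗ[A.carrier] N.carrier) : Prop :=
  LinearMap.lTensor H (f.restrictScalars k) ∘ₗ M.coact = N.coact ∘ₗ f.restrictScalars k

/-- `A ⟶ B` in `Alg C` is flat if `B ⊗_A - : Mod_C A ⥤ Mod_C B` is an exact functor. Over a field,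
kernels and images in `Mod_C A` and in `Mod_C B` are those of the underlying linear maps, so that a
sequence in either category is exact if and only if it is exact as a sequence of vector spaces; and
the linear map underlying `B ⊗_A f` is the usual one. Only `A`-modules *in `Ind C`* are tested. -/
def IsFlat {A B : ComodAlg k H} (φ : A ⟶ B) : Prop :=
  letI : Algebra A.carrier B.carrier := φ.toAlgHom.toRingHom.toAlgebra
  ∀ (M N P : EquivModule A) (f : M.carrier →ₗ[A.carrier] N.carrier)
    (g : N.carrier →ₗ[A.carrier] P.carrier),
    EquivModule.IsEquivariant f → EquivModule.IsEquivariant g → Function.Exact f g →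
      Function.Exact (LinearMap.lTensor B.carrier f) (LinearMap.lTensor B.carrier g)

/-- `A ⟶ B` in `Alg C` is faithful if the functor `B ⊗_A - : Mod_C A ⥤ Mod_C B` is faithful. -/
def IsFaithful {A B : ComodAlg k H} (φ : A ⟶ B) : Prop :=
  letI : Algebra A.carrier B.carrier := φ.toAlgHom.toRingHom.toAlgebra
  ∀ (M N : EquivModule A) (f g : M.carrier →ₗ[A.carrier] N.carrier),
    EquivModule.IsEquivariant f → EquivModule.IsEquivariant g →
      LinearMap.lTensor B.carrier f = LinearMap.lTensor B.carrier g → f = g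

/-- Faithful flatness in `Alg C`. -/
def IsFaithfullyFlat {A B : ComodAlg k H} (φ : A ⟶ B) : Prop :=
  IsFlat φ ∧ IsFaithful φ

end

section
variable (k : CommRingCat.{u}) (H : Type u) [CommRing H] [HopfAlgebra k H]

/-- The category `Aff C = (Alg C)ᵒᵖ` of affine schemes in `C`. -/
abbrev Aff : Type (u + 1) := (ComodAlg k H)ᵒᵖ

/-- The category `Fun C` of presheaves of sets on `Aff C`. -/
abbrev Fun : Type (u + 1) := (Aff k H)ᵒᵖ ⥤ Type u

/-- The covers of the fpqc pretopology on `Aff C`: they correspond to the finite (possibly empty)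
families `f i : A ⟶ B i` in `Alg C` for which `A ⟶ ∏ B i` is faithfully flat. -/
def fpqc : Precoverage (Aff k H) where
  coverings A := {R | ∃ (n : ℕ) (B : Fin n → ComodAlg k H) (f : ∀ i, A.unop ⟶ B i),
    IsFaithfullyFlat (ComodAlg.piLift B f) ∧
      R = Presieve.ofArrows (fun i => op (B i)) (fun i => (f i).op)}

variable {k H} in
/-- `F` is a sheaf for the fpqc pretopology, i.e. it belongs to `Fais C`: for every fpqc cover,
every compatible family of sections has a unique amalgamation. -/
def IsFaisceau (F : Fun k H) : Prop :=
  ∀ (A : Aff k H), ∀ R ∈ fpqc k H A, R.IsSheafFor F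

/-- The affine `k`-scheme `Spec A` of a commutative `k`-algebra `A`. -/
abbrev specAlg (A : Type u) [CommRing A] [Algebra k A] : Over (Spec k) :=
  (algSpec k).obj (op (CommAlgCat.of k A))

/-- `Spec H` is a group scheme over `k`, with multiplication induced by the comultiplication. -/
instance : GrpObj (specAlg k H) := ((hopfSpec k).obj (op (CommHopfAlgCat.of k H))).grp

variable {k H}
lemma specAlg_mul : μ[specAlg k H] =
    Functor.LaxMonoidal.μ (algSpec k) _ _ ≫
      (algSpec k).map (CommAlgCat.ofHom (Bialgebra.comulAlgHom k H)).op := rfl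

lemma specAlg_one : η[specAlg k H] =
    Functor.LaxMonoidal.ε (algSpec k) ≫
      (algSpec k).map (CommAlgCat.ofHom (Bialgebra.counitAlgHom k H)).op := rfl

/-- The action `Spec H × Spec A ≅ Spec (H ⊗ A) ⟶ Spec A` induced by the coaction of `A`. -/
def actionMap (A : ComodAlg k H) :
    specAlg k H ⊗ specAlg k A.carrier ⟶ specAlg k A.carrier :=
  Functor.LaxMonoidal.μ (algSpec k) (op (CommAlgCat.of k H)) (op (CommAlgCat.of k A.carrier)) ≫
    (algSpec k).map (CommAlgCat.ofHom A.coact).op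

lemma lax_one_smul {C D : Type*} [Category C] [Category D] [MonoidalCategory C]
    [MonoidalCategory D] (F : C ⥤ D) [F.LaxMonoidal] {M X : C} (e : 𝟙_ C ⟶ M) (a : M ⊗ X ⟶ X)
    (h : e ▷ X ≫ a = (λ_ X).hom) :
    (Functor.LaxMonoidal.ε F ≫ F.map e) ▷ F.obj X ≫ Functor.LaxMonoidal.μ F M X ≫ F.map a =
      (λ_ (F.obj X)).hom := by
  rw [comp_whiskerRight, Category.assoc, Functor.LaxMonoidal.μ_natural_left_assoc, ← F.map_comp, h,
    Functor.LaxMonoidal.left_unitality]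

lemma lax_mul_smul {C D : Type*} [Category C] [Category D] [MonoidalCategory C]
    [MonoidalCategory D] (F : C ⥤ D) [F.LaxMonoidal] {M X : C} (m : M ⊗ M ⟶ M) (a : M ⊗ X ⟶ X)
    (h : m ▷ X ≫ a = (α_ M M X).hom ≫ M ◁ a ≫ a) :
    (Functor.LaxMonoidal.μ F M M ≫ F.map m) ▷ F.obj X ≫ Functor.LaxMonoidal.μ F M X ≫ F.map a =
      (α_ _ _ _).hom ≫ F.obj M ◁ (Functor.LaxMonoidal.μ F M X ≫ F.map a) ≫
        Functor.LaxMonoidal.μ F M X ≫ F.map a := by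
  rw [comp_whiskerRight, Category.assoc, Functor.LaxMonoidal.μ_natural_left_assoc, ← F.map_comp, h,
    F.map_comp, F.map_comp, whiskerLeft_comp, Category.assoc,
    Functor.LaxMonoidal.μ_natural_right_assoc, Functor.LaxMonoidal.associativity_assoc]

/-- `Spec A`, for `A` in `Alg C`, is a scheme with an action of the group scheme `Spec H`. -/
instance (A : ComodAlg k H) : ModObj (specAlg k H) (specAlg k A.carrier) where
  smul := actionMap A
  one_smul := by
    refine lax_one_smul (algSpec k) (CommAlgCat.ofHom (Bialgebra.counitAlgHom k H)).op
      (X := op (CommAlgCat.of k A.carrier)) (CommAlgCat.ofHom A.coact).op ?_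
    apply Quiver.Hom.unop_inj
    ext x
    have h := congrArg (fun y => (1 : k) ⊗ₜ[k] y) (DFunLike.congr_fun A.counit_coact x)
    refine Eq.trans ?_ h
    exact ((Algebra.TensorProduct.lid k A.carrier).symm_apply_apply _).symm
  mul_smul := by
    refine lax_mul_smul (algSpec k) (CommAlgCat.ofHom (Bialgebra.comulAlgHom k H)).op
      (X := op (CommAlgCat.of k A.carrier)) (CommAlgCat.ofHom A.coact).op ?_
    apply Quiver.Hom.unop_inj
    ext x
    have h := congrArg (Algebra.TensorProduct.assoc k k k H H A.carrier).symm
      (DFunLike.congr_fun A.coassoc x)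
    refine Eq.trans ?_ h
    exact ((Algebra.TensorProduct.assoc k k k H H A.carrier).symm_apply_apply _).symm

lemma lax_equivariant {C D : Type*} [Category C] [Category D] [MonoidalCategory C]
    [MonoidalCategory D] (F : C ⥤ D) [F.LaxMonoidal] {M X Y : C} (a : M ⊗ X ⟶ X) (b : M ⊗ Y ⟶ Y)
    (f : X ⟶ Y) (h : a ≫ f = M ◁ f ≫ b) :
    (Functor.LaxMonoidal.μ F M X ≫ F.map a) ≫ F.map f =
      F.obj M ◁ F.map f ≫ Functor.LaxMonoidal.μ F M Y ≫ F.map b := by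
  rw [Functor.LaxMonoidal.μ_natural_right_assoc, Category.assoc, ← Functor.map_comp,
    ← Functor.map_comp, h]

lemma isModHom_spec {A B : ComodAlg k H} (φ : A ⟶ B) :
    actionMap B ≫ (algSpec k).map (CommAlgCat.ofHom φ.toAlgHom).op =
      specAlg k H ◁ (algSpec k).map (CommAlgCat.ofHom φ.toAlgHom).op ≫ actionMap A := by
  refine lax_equivariant (algSpec k) (M := op (CommAlgCat.of k H))
    (CommAlgCat.ofHom B.coact).op (CommAlgCat.ofHom A.coact).op
    (CommAlgCat.ofHom φ.toAlgHom).op ?_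
  apply Quiver.Hom.unop_inj
  ext x
  exact (DFunLike.congr_fun φ.comm x).symm

variable (k H) in
/-- The functor from `Aff C` to `k`-schemes with an action of the group scheme `Spec H`. -/
def specFunctor : Aff k H ⥤ Mod (Over (Spec k)) (specAlg k H) where
  obj A := { X := specAlg k A.unop.carrier }
  map φ := Mod.Hom.mk'' ((algSpec k).map (CommAlgCat.ofHom φ.unop.toAlgHom).op)
    (isModHom_spec φ.unop)
  map_id A := Mod.hom_ext _ _ (((ComodAlg.forget k H).op ⋙ algSpec k).map_id A)
  map_comp f g := Mod.hom_ext _ _ (((ComodAlg.forget k H).op ⋙ algSpec k).map_comp f g)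
end

section
variable (k : CommRingCat.{u}) (G : Scheme.{u}) [G.Over (Spec k)] [GrpObj (G.asOver (Spec k))]
  [IsAffine G]

lemma comul_eq_mul (A : (CommAlgCat.{u} k)ᵒᵖ) [GrpObj A] :
    (CommAlgCat.ofHom (Bialgebra.comulAlgHom k A.unop)).op = μ[A] := rfl

lemma counit_eq_one (A : (CommAlgCat.{u} k)ᵒᵖ) [GrpObj A] :
    (CommAlgCat.ofHom (Bialgebra.counitAlgHom k A.unop)).op = η[A] := rfl

/-- The coordinate algebra `O(G)` of an affine group scheme `G` over `k`, with its structure of a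
Hopf algebra over `k`. -/
def CoordRing (_k : CommRingCat.{u}) (G : Scheme.{u}) : Type u := Γ(G, ⊤)
instance : CommRing (CoordRing k G) := inferInstanceAs (CommRing Γ(G, ⊤))
instance : HopfAlgebra k (CoordRing k G) := inferInstanceAs (HopfAlgebra k Γ(G, ⊤))

/-- The canonical isomorphism `G ≅ Spec O(G)` over `k`. -/
def isoSpecCoordRing : G.asOver (Spec k) ≅ specAlg k (CoordRing k G) :=
  G.isoSpec.asOver (Spec k)

/-- The group object corresponding to `O(G)` in the opposite category of `k`-algebras. -/
abbrev grpΓ : GrpObj (op (CommAlgCat.of k Γ(G, ⊤))) :=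
  have : GrpObj ((algSpec k).obj <| .op <| CommAlgCat.of k Γ(G, ⊤)) :=
    .ofIso <| G.isoSpec.asOver (Spec k)
  algSpec.fullyFaithful.grpObj _

lemma map_comul : (algSpec k).map
      (CommAlgCat.ofHom (Bialgebra.comulAlgHom k (CoordRing k G))).op =
    Functor.OplaxMonoidal.δ (algSpec k) _ _ ≫ (MonObj.ofIso (isoSpecCoordRing k G)).mul := by
  let := grpΓ k G
  refine (congrArg (algSpec k).map (comul_eq_mul k (op (CommAlgCat.of k Γ(G, ⊤))))).trans ?_
  exact algSpec.fullyFaithful.map_preimage _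

lemma map_counit : (algSpec k).map
      (CommAlgCat.ofHom (Bialgebra.counitAlgHom k (CoordRing k G))).op =
    Functor.OplaxMonoidal.η (algSpec k) ≫ (MonObj.ofIso (isoSpecCoordRing k G)).one := by
  let := grpΓ k G
  refine (congrArg (algSpec k).map (counit_eq_one k (op (CommAlgCat.of k Γ(G, ⊤))))).trans ?_
  exact algSpec.fullyFaithful.map_preimage _

/-- `G ≅ Spec O(G)` is an isomorphism of group schemes. -/
instance : IsMonHom (isoSpecCoordRing k G).hom where
  one_hom := by
    rw [specAlg_one, map_counit, Functor.Monoidal.ε_η_assoc]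
    rfl
  mul_hom := by
    rw [specAlg_mul, map_comul, Functor.Monoidal.μ_δ_assoc]
    simp [MonObj.ofIso_mul]

/-- The category of pairs `(X, a)` of a `k`-scheme `X` and an action `a : G × X ⟶ X`, with the
`G`-equivariant morphisms of `k`-schemes. -/
abbrev GSch : Type (u + 1) := Mod (Over (Spec k)) (G.asOver (Spec k))

/-- The functor sending `A` in `Alg C` to the affine `k`-scheme of `ω A` with its canonical
`G`-action `G × Spec A ≅ Spec O(G) × Spec A ⟶ Spec A`. -/
def specG : Aff k (CoordRing k G) ⥤ GSch k G :=
  specFunctor k (CoordRing k G) ⋙ Mod.comap (isoSpecCoordRing k G).hom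

/-- The functor `X ↦ H_X`, `H_X(A) = Hom_G(Spec A, X)`. -/
def pointsFunctor : GSch k G ⥤ Fun k (CoordRing k G) :=
  yoneda ⋙ (Functor.whiskeringLeft _ _ _).obj (specG k G).op

end

end

end EquivGeom

/-! Write `H` for the coordinate ring of `G`. Everything rests on cofree objects. For a `k`-algebra
`R`, the comodule algebra `H ⊗ R` is the coordinate ring of the free `G`-scheme `G × Spec R`, so
equivariant morphisms from it to `X` are the same as `R`-points of `X`: restrict to the unit
section, or extend by `(g, r) ↦ g • x r` (`extend`, `extend_unitSection_comp`).

Full faithfulness: the functor of equivariant points thus contains the ordinary functor of points of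
`X` on affine `k`-schemes. A natural transformation of equivariant points induces one of ordinary
points, which glues to a morphism of schemes over an affine cover (`exists_hom_of_affine_points`).
It is equivariant because the action itself can be read off from `extend`.

Faisceau property: the covers are defined by testing equivariant modules only, yet they are
faithfully flat in the usual sense (`faithfullyFlat_of_isFaithfullyFlat`). For an `A`-module `M`,
the cofree module `H ⊗ M` is equivariant. The antipode gives a section, natural in `M`, of `B ⊗_A (H
⊗ M) → B ⊗_A M`, and the `H`-multiples of its image generate the source. So flatness and
faithfulness pass from cofree modules to all modules. A morphism then descends because representable
functors are fpqc sheaves, and it is equivariant because this may be checked on the pulled back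
cover of `G × Spec A` (`existsUnique_equivHom`). -/

namespace EquivGeom

noncomputable section

open TensorProduct

/-! ### Cofree equivariant modules. -/

section FaithfullyFlat

variable {k : CommRingCat.{u}} {H : Type u} [CommRing H] [HopfAlgebra k H]

/-- The action of `H ⊗ R` on `H ⊗ M` for an `R`-module `M`. -/
def tensorAct (H : Type u) [CommRing H] [HopfAlgebra k H] (R : Type u) [CommRing R] [Algebra k R]
    (M : Type u) [AddCommGroup M] [Module k M] [Module R M] [IsScalarTower k R M] :
    H ⊗[k] R →ₐ[k] Module.End k (H ⊗[k] M) :=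
  (Module.endTensorEndAlgHom (R := k) (S := k) (A := k) (M := H) (N := M)).comp
    (Algebra.TensorProduct.map (Algebra.lmul k H) (Algebra.lsmul k k M))

@[simp]
lemma tensorAct_tmul_tmul (R : Type u) [CommRing R] [Algebra k R]
    (M : Type u) [AddCommGroup M] [Module k M] [Module R M] [IsScalarTower k R M]
    (h h' : H) (r : R) (m : M) :
    tensorAct H R M (h ⊗ₜ[k] r) (h' ⊗ₜ[k] m) = (h * h') ⊗ₜ[k] (r • m) := by
  simp only [tensorAct, AlgHom.comp_apply, Algebra.TensorProduct.map_tmul]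
  rw [Module.endTensorEndAlgHom_apply]
  rfl

/-- The map `h ⊗ m ↦ Δ(h) ⊗ m`. -/
def cofreeCoact (H : Type u) [CommRing H] [HopfAlgebra k H] (M : Type u) [AddCommGroup M]
    [Module k M] : H ⊗[k] M →ₗ[k] H ⊗[k] (H ⊗[k] M) :=
  (TensorProduct.assoc k H H M).toLinearMap ∘ₗ
    LinearMap.rTensor M (Coalgebra.comul (R := k) (A := H))

lemma cofreeCoact_tmul (M : Type u) [AddCommGroup M] [Module k M] (h : H) (m : M) :
    cofreeCoact (k := k) H M (h ⊗ₜ m) =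
      TensorProduct.assoc k H H M (Coalgebra.comul (R := k) h ⊗ₜ m) := rfl

lemma cofreeCoact_counit (M : Type u) [AddCommGroup M] [Module k M] :
    (TensorProduct.lid k (H ⊗[k] M)).toLinearMap ∘ₗ
      LinearMap.rTensor (H ⊗[k] M) (Coalgebra.counit (R := k) (A := H)) ∘ₗ cofreeCoact H M =
      LinearMap.id := by
  refine TensorProduct.ext' fun h m => ?_
  have key : ∀ d : H ⊗[k] H, TensorProduct.lid k (H ⊗[k] M)
      (LinearMap.rTensor (H ⊗[k] M) (Coalgebra.counit (R := k) (A := H))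
        (TensorProduct.assoc k H H M (d ⊗ₜ m))) =
      (TensorProduct.lid k H (LinearMap.rTensor H (Coalgebra.counit (R := k) (A := H)) d)) ⊗ₜ m := by
    intro d
    induction d with
    | zero => simp
    | add x y hx hy => simp only [map_add, add_tmul, hx, hy]
    | tmul x y => simp [smul_tmul']
  simp [cofreeCoact_tmul, key]

/-- Coassociativity of `Δ` tensored with `M`: for fixed `m`, both sides are the image under one
linear map `T` of the two sides of the coassociativity law for `h`. -/
lemma cofreeCoact_coassoc (M : Type u) [AddCommGroup M] [Module k M] :
    (TensorProduct.assoc k H H (H ⊗[k] M)).toLinearMap ∘ₗ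
      LinearMap.rTensor (H ⊗[k] M) (Coalgebra.comul (R := k) (A := H)) ∘ₗ cofreeCoact H M =
      LinearMap.lTensor H (cofreeCoact H M) ∘ₗ cofreeCoact H M := by
  refine TensorProduct.ext' fun h m => ?_
  let T : H ⊗[k] (H ⊗[k] H) →ₗ[k] H ⊗[k] (H ⊗[k] (H ⊗[k] M)) :=
    LinearMap.lTensor H ((TensorProduct.assoc k H H M).toLinearMap ∘ₗ
      (TensorProduct.mk k (H ⊗[k] H) M).flip m)
  have k1 : ∀ d : H ⊗[k] H, TensorProduct.assoc k H H (H ⊗[k] M)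
      (LinearMap.rTensor (H ⊗[k] M) (Coalgebra.comul (R := k) (A := H))
        (TensorProduct.assoc k H H M (d ⊗ₜ m))) =
      T (TensorProduct.assoc k H H H
        (LinearMap.rTensor H (Coalgebra.comul (R := k) (A := H)) d)) := by
    intro d
    induction d with
    | zero => simp
    | add x y hx hy => simp only [map_add, add_tmul, hx, hy]
    | tmul x y =>
      simp only [assoc_tmul, LinearMap.rTensor_tmul]
      generalize (Coalgebra.comul (R := k) x) = e
      induction e with
      | zero => simp
      | add x y hx hy => simp only [map_add, add_tmul, hx, hy]
      | tmul a b => simp [T]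
  have k2 : ∀ d : H ⊗[k] H, LinearMap.lTensor H (cofreeCoact H M)
        (TensorProduct.assoc k H H M (d ⊗ₜ m)) =
      T (LinearMap.lTensor H (Coalgebra.comul (R := k) (A := H)) d) := by
    intro d
    induction d with
    | zero => simp
    | add x y hx hy => simp only [map_add, add_tmul, hx, hy]
    | tmul x y => simp [T, cofreeCoact_tmul]
  simp [cofreeCoact_tmul, k1, k2]

/-- The underlying `k`-module of the cofree equivariant module. -/
@[nolint unusedArguments]
def CofreeCarrier (_A : ComodAlg k H) (M : Type u) [AddCommGroup M] [Module k M] : Type u :=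
  H ⊗[k] M

section
variable (A : ComodAlg k H) (M : Type u) [AddCommGroup M] [Module k M]

instance : AddCommGroup (CofreeCarrier A M) := inferInstanceAs (AddCommGroup (H ⊗[k] M))
instance : Module k (CofreeCarrier A M) := inferInstanceAs (Module k (H ⊗[k] M))

variable [Module A.carrier M] [IsScalarTower k A.carrier M]

/-- `A` acts on `H ⊗ M` through the coaction `A → H ⊗ A`. -/
instance : Module A.carrier (CofreeCarrier A M) :=
  Module.compHom (H ⊗[k] M) ((tensorAct H A.carrier M).comp A.coact).toRingHom

lemma cofree_smul (a : A.carrier) (x : H ⊗[k] M) :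
    (a • (show CofreeCarrier A M from x) : CofreeCarrier A M) =
      tensorAct H A.carrier M (A.coact a) x := rfl

instance cofree_isScalarTower : IsScalarTower k A.carrier (CofreeCarrier A M) :=
  IsScalarTower.of_algebraMap_smul fun r x => by
    refine (cofree_smul A M _ x).trans ?_
    rw [AlgHom.commutes, AlgHom.commutes]
    rfl

/-- `Δ` is multiplicative. -/
lemma cofreeCoact_tensorAct {R : Type u} [CommRing R] [Algebra k R] [Module R M]
    [IsScalarTower k R M] (v : H ⊗[k] R) (x : H ⊗[k] M) :
    cofreeCoact H M (tensorAct H R M v x) =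
      TensorProduct.map₂ (LinearMap.mul k H) (tensorAct H R M).toLinearMap
        (cofreeCoact H R v) (cofreeCoact H M x) := by
  induction v with
  | zero => simp
  | add v w hv hw => simp only [map_add, LinearMap.add_apply, hv, hw]
  | tmul h r =>
    induction x with
    | zero => simp
    | add x y hx hy => simp only [map_add, hx, hy]
    | tmul h' m =>
      simp only [tensorAct_tmul_tmul, cofreeCoact_tmul, Bialgebra.comul_mul]
      generalize (Coalgebra.comul (R := k) h) = e
      generalize (Coalgebra.comul (R := k) h') = e'
      induction e with
      | zero => simp
      | add x y hx hy => simp only [map_add, add_tmul, add_mul, LinearMap.add_apply, hx, hy]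
      | tmul a b =>
        induction e' with
        | zero => simp
        | add x y hx hy => simp only [map_add, add_tmul, mul_add, hx, hy]
        | tmul a' b' => simp

/-- The cofree equivariant module `H ⊗ M` on an `A`-module `M`. -/
def cofreeModule : EquivModule A where
  carrier := CofreeCarrier A M
  addCommGroup := inferInstance
  baseModule := inferInstance
  module := inferInstance
  isScalarTower := cofree_isScalarTower A M
  coact := cofreeCoact H M
  counit_coact := cofreeCoact_counit M
  coassoc := cofreeCoact_coassoc M
  coact_smul a m := by
    refine (cofreeCoact_tensorAct M (A.coact a) m).trans ?_
    -- Multiplicativity of `Δ` leaves `Δ` applied to the first factor of `A.coact a`.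
    -- Coassociativity moves this to a second coaction on `A`, which is how `a` acts on `H ⊗ M`.
    have h := DFunLike.congr_fun A.coassoc a
    have h' : cofreeCoact H A.carrier (A.coact a) =
        LinearMap.lTensor H A.coact.toLinearMap (A.coact a) := h
    rw [h']
    generalize A.coact a = v
    change _ = TensorProduct.map₂ (LinearMap.mul k H) _ v (cofreeCoact H M m)
    generalize cofreeCoact H M m = x
    induction v with
    | zero => simp
    | add v w hv hw => simp only [map_add, LinearMap.add_apply, hv, hw]
    | tmul h r =>
      induction x with
      | zero => simp
      | add x y hx hy => simp only [map_add, hx, hy]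
      | tmul h' y =>
        simp only [LinearMap.lTensor_tmul, TensorProduct.map₂_apply_tmul]
        rfl

end

section
variable (A : ComodAlg k H) {M N : Type u} [AddCommGroup M] [Module k M]
  [Module A.carrier M] [IsScalarTower k A.carrier M] [AddCommGroup N] [Module k N]
  [Module A.carrier N] [IsScalarTower k A.carrier N]

/-- Functoriality of the cofree equivariant module. -/
def cofreeMap (f : M →ₗ[A.carrier] N) : (cofreeModule A M).carrier →ₗ[A.carrier]
    (cofreeModule A N).carrier where
  toFun := LinearMap.lTensor H (f.restrictScalars k)
  map_add' := map_add _
  map_smul' a x := by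
    change LinearMap.lTensor H (f.restrictScalars k) (tensorAct H A.carrier M (A.coact a) x) =
      tensorAct H A.carrier N (A.coact a) (LinearMap.lTensor H (f.restrictScalars k) x)
    generalize A.coact a = v
    revert x
    intro (x : H ⊗[k] M)
    induction v with
    | zero => simp
    | add v w hv hw => simp only [map_add, LinearMap.add_apply, hv, hw]
    | tmul h r =>
      induction x with
      | zero => simp
      | add x y hx hy => simp only [map_add, hx, hy]
      | tmul h' y => simp

lemma cofreeMap_isEquivariant (f : M →ₗ[A.carrier] N) :
    EquivModule.IsEquivariant (cofreeMap A f) := by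
  refine TensorProduct.ext' fun h m => ?_
  change LinearMap.lTensor H (LinearMap.lTensor H (f.restrictScalars k)) (cofreeCoact H M (h ⊗ₜ m)) =
    cofreeCoact H N (h ⊗ₜ f m)
  rw [cofreeCoact_tmul, cofreeCoact_tmul]
  generalize (Coalgebra.comul (R := k) h) = e
  induction e with
  | zero => simp
  | add x y hx hy => simp only [map_add, add_tmul, hx, hy]
  | tmul a b => simp

variable (M) in
/-- The map `ε ⊗ M : H ⊗ M → M`. -/
def cofreeCounit : (cofreeModule A M).carrier →ₗ[A.carrier] M where
  toFun := (TensorProduct.lid k M).toLinearMap ∘ₗ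
      LinearMap.rTensor M (Coalgebra.counit (R := k) (A := H))
  map_add' := map_add _
  map_smul' a x := by
    change TensorProduct.lid k M (LinearMap.rTensor M (Coalgebra.counit (R := k) (A := H))
      (tensorAct H A.carrier M (A.coact a) x)) =
      a • (TensorProduct.lid k M (LinearMap.rTensor M (Coalgebra.counit (R := k) (A := H)) x))
    have h1 := DFunLike.congr_fun A.counit_coact a
    simp only [AlgHom.comp_apply, AlgHom.id_apply] at h1
    conv_rhs => rw [← h1]
    generalize A.coact a = v
    revert x
    intro (x : H ⊗[k] M)
    induction v with
    | zero => simp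
    | add v w hv hw => simp only [map_add, LinearMap.add_apply, hv, hw, add_smul]
    | tmul h r =>
      induction x with
      | zero => simp
      | add x y hx hy => simp only [map_add, hx, hy, smul_add]
      | tmul h' y => simp [mul_smul, smul_comm r (Coalgebra.counit (R := k) h') y]

variable (M) in
/-- Multiplication by `h` on `H ⊗ M`. -/
def cofreeMul (h : H) : (cofreeModule A M).carrier →ₗ[A.carrier] (cofreeModule A M).carrier where
  toFun := LinearMap.rTensor M (LinearMap.mul k H h)
  map_add' := map_add _
  map_smul' a x := by
    change LinearMap.rTensor M (LinearMap.mul k H h) (tensorAct H A.carrier M (A.coact a) x) =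
      tensorAct H A.carrier M (A.coact a) (LinearMap.rTensor M (LinearMap.mul k H h) x)
    generalize A.coact a = v
    revert x
    intro (x : H ⊗[k] M)
    induction v with
    | zero => simp
    | add v w hv hw => simp only [map_add, LinearMap.add_apply, hv, hw]
    | tmul h r =>
      induction x with
      | zero => simp
      | add x y hx hy => simp only [map_add, hx, hy]
      | tmul h' y => simp [mul_left_comm]

end

end FaithfullyFlat

end

end EquivGeom

namespace EquivGeom

noncomputable section

open TensorProduct

/-! ### The antipode, and equivariant versus ordinary faithful flatness. -/

section FaithfullyFlat

variable {k : CommRingCat.{u}} {H : Type u} [CommRing H] [HopfAlgebra k H]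

section Antipode
variable (A : ComodAlg k H)

/-- `h ⊗ x ↦ (S(h) ⊗ 1) x`. -/
def antipodeMul : H ⊗[k] (H ⊗[k] A.carrier) →ₐ[k] H ⊗[k] A.carrier :=
  Algebra.TensorProduct.lift
    (Algebra.TensorProduct.includeLeft.comp (HopfAlgebra.antipodeAlgHom k H)) (AlgHom.id k _)
    fun _ _ => Commute.all _ _

/-- `h ⊗ x ↦ (h ⊗ 1) (S ⊗ A)(x)`. -/
def mulAntipode : H ⊗[k] (H ⊗[k] A.carrier) →ₐ[k] H ⊗[k] A.carrier :=
  Algebra.TensorProduct.lift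
    Algebra.TensorProduct.includeLeft
    (Algebra.TensorProduct.map (HopfAlgebra.antipodeAlgHom k H) (AlgHom.id k _))
    fun _ _ => Commute.all _ _

lemma one_tmul_lid_counit (v : H ⊗[k] A.carrier) :
    LinearMap.rTensor A.carrier (Algebra.linearMap k H ∘ₗ Coalgebra.counit (R := k) (A := H)) v =
    (1 : H) ⊗ₜ[k] Algebra.TensorProduct.lid k A.carrier
      (Algebra.TensorProduct.map (Bialgebra.counitAlgHom k H) (AlgHom.id k A.carrier) v) := by
  induction v with
  | zero => simp
  | add x y hx hy => simp only [map_add, tmul_add, hx, hy]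
  | tmul h a =>
    simp [Algebra.algebraMap_eq_smul_one, smul_tmul]

/-- In Sweedler notation, `S(a₋₂) a₋₁ ⊗ a₀ = 1 ⊗ a`: coassociativity, then the antipode law, then
the counit law. This makes `cofreeSection` balanced over `A`. -/
lemma antipodeMul_coact (a : A.carrier) :
    antipodeMul A (Algebra.TensorProduct.map (AlgHom.id k H) A.coact (A.coact a)) =
      (1 : H) ⊗ₜ[k] a := by
  have h := DFunLike.congr_fun A.coassoc a
  have h1 := DFunLike.congr_fun A.counit_coact a
  simp only [AlgHom.comp_apply, AlgHom.id_apply] at h h1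
  rw [← h]
  refine Eq.trans ?_ ((one_tmul_lid_counit A (A.coact a)).trans
    (congrArg (fun y => (1 : H) ⊗ₜ[k] y) h1))
  generalize A.coact a = v
  induction v with
  | zero => simp
  | add x y hx hy => simp only [map_add, hx, hy]
  | tmul h a =>
    have key : ∀ d : H ⊗[k] H, antipodeMul A (Algebra.TensorProduct.assoc k k k H H A.carrier
        (d ⊗ₜ a)) = LinearMap.mul' k H
          (LinearMap.rTensor H (HopfAlgebra.antipode k) d) ⊗ₜ[k] a := by
      intro d
      induction d with
      | zero => simp
      | add x y hx hy => simp only [map_add, add_tmul, hx, hy]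
      | tmul x y => simp [antipodeMul]
    simpa using key (Coalgebra.comul (R := k) h)

/-- The mirror identity `a₋₂ S(a₋₁) ⊗ a₀ = 1 ⊗ a`. It writes `1 ⊗ b` through `H`-multiples of the
elements `S(b₋₁) ⊗ b₀`, as needed in `subsingleton_tensor_cofree`. -/
lemma mulAntipode_coact (a : A.carrier) :
    mulAntipode A (Algebra.TensorProduct.map (AlgHom.id k H) A.coact (A.coact a)) =
      (1 : H) ⊗ₜ[k] a := by
  have h := DFunLike.congr_fun A.coassoc a
  have h1 := DFunLike.congr_fun A.counit_coact a
  simp only [AlgHom.comp_apply, AlgHom.id_apply] at h h1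
  rw [← h]
  refine Eq.trans ?_ ((one_tmul_lid_counit A (A.coact a)).trans
    (congrArg (fun y => (1 : H) ⊗ₜ[k] y) h1))
  generalize A.coact a = v
  induction v with
  | zero => simp
  | add x y hx hy => simp only [map_add, hx, hy]
  | tmul h a =>
    have key : ∀ d : H ⊗[k] H, mulAntipode A (Algebra.TensorProduct.assoc k k k H H A.carrier
        (d ⊗ₜ a)) = LinearMap.mul' k H
          (LinearMap.lTensor H (HopfAlgebra.antipode k) d) ⊗ₜ[k] a := by
      intro d
      induction d with
      | zero => simp
      | add x y hx hy => simp only [map_add, add_tmul, hx, hy]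
      | tmul x y => simp [mulAntipode]
    simpa using key (Coalgebra.comul (R := k) h)

end Antipode

section
variable {A B : ComodAlg k H} [Algebra A.carrier B.carrier] [IsScalarTower k A.carrier B.carrier]
  (M : Type u) [AddCommGroup M] [Module k M] [Module A.carrier M] [IsScalarTower k A.carrier M]

/-- The identity map from `H ⊗ M` to the carrier of the cofree module. -/
def cofreeOf (A : ComodAlg k H) {M : Type u} [AddCommGroup M] [Module k M] [Module A.carrier M]
    [IsScalarTower k A.carrier M] : H ⊗[k] M →+ (cofreeModule A M).carrier :=
  AddMonoidHom.id (H ⊗[k] M)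

/-- The pure tensor `h ⊗ m` in the cofree module. -/
def cofreeMk (A : ComodAlg k H) {M : Type u} [AddCommGroup M] [Module k M] [Module A.carrier M]
    [IsScalarTower k A.carrier M] (h : H) (m : M) : (cofreeModule A M).carrier :=
  cofreeOf A (h ⊗ₜ[k] m)

variable (B) in
/-- The pairing `(h ⊗ b, m) ↦ b ⊗ (h ⊗ m)`. -/
def cofreePairing : H ⊗[k] B.carrier →+
    (M →+ B.carrier ⊗[A.carrier] (cofreeModule A M).carrier) :=
  TensorProduct.liftAddHom
    (AddMonoidHom.mk' (fun h => AddMonoidHom.mk' (fun b => AddMonoidHom.mk'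
      (fun m => b ⊗ₜ[A.carrier] cofreeMk A h m)
      (fun m n => by rw [cofreeMk, tmul_add]; exact tmul_add _ _ _))
      (fun b c => by ext m; exact add_tmul _ _ _))
      (fun h h' => by
        ext b m
        change b ⊗ₜ[A.carrier] cofreeMk A (h + h') m = _
        rw [cofreeMk, add_tmul]; exact tmul_add _ _ _))
    (fun c h b => by
      ext m
      change b ⊗ₜ[A.carrier] cofreeMk A (c • h) m = (c • b) ⊗ₜ[A.carrier] cofreeMk A h m
      rw [smul_tmul]; rfl)

lemma cofreePairing_tmul (h : H) (b : B.carrier) (m : M) :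
    cofreePairing (A := A) B M (h ⊗ₜ b) m = b ⊗ₜ[A.carrier] cofreeMk A h m := rfl

lemma cofreePairing_mul_left (h : H) (w : H ⊗[k] B.carrier) (m : M) :
    cofreePairing (A := A) B M ((h ⊗ₜ 1) * w) m =
      LinearMap.lTensor B.carrier (cofreeMul A M h) (cofreePairing B M w m) := by
  induction w with
  | zero => simp
  | add x y hx hy => simp only [map_add, mul_add, AddMonoidHom.add_apply, hx, hy]
  | tmul h' b =>
    rw [Algebra.TensorProduct.tmul_mul_tmul, one_mul, cofreePairing_tmul, cofreePairing_tmul]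
    rfl

/-- Moving `a` across the tensor product over `A` turns it into `A.coact a` acting on `H ⊗ M`, where
it meets `S(h')`. With `v = A.coact a`, `antipodeMul_coact` then cancels the twist. -/
lemma cofreePairing_mul_coact (f : A.carrier →ₐ[k] B.carrier)
    (hf : ∀ a, algebraMap A.carrier B.carrier a = f a)
    (v : H ⊗[k] A.carrier) (h : H) (b : B.carrier) (m : M) :
    cofreePairing (A := A) B M
      (Algebra.TensorProduct.map (HopfAlgebra.antipodeAlgHom k H) f v * (h ⊗ₜ b)) m =
      b ⊗ₜ[A.carrier] cofreeOf A (tensorAct H A.carrier M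
        (antipodeMul A (Algebra.TensorProduct.map (AlgHom.id k H) A.coact v)) (h ⊗ₜ m)) := by
  induction v with
  | zero => simp
  | add x y hx hy =>
    simp only [map_add, add_mul, AddMonoidHom.add_apply, LinearMap.add_apply, hx, hy, tmul_add]
  | tmul h' a =>
    rw [Algebra.TensorProduct.map_tmul, Algebra.TensorProduct.tmul_mul_tmul, cofreePairing_tmul,
      ← hf, ← Algebra.smul_def, smul_tmul]
    congr 1
    change cofreeOf A (tensorAct H A.carrier M (A.coact a) ((HopfAlgebra.antipodeAlgHom k H h' * h) ⊗ₜ m)) = _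
    simp only [antipodeMul, Algebra.TensorProduct.map_tmul, Algebra.TensorProduct.lift_tmul,
      map_mul, AlgHom.comp_apply, AlgHom.id_apply, Algebra.TensorProduct.includeLeft_apply,
      Module.End.mul_apply]
    generalize A.coact a = w
    rw [← Module.End.mul_apply, ← map_mul, mul_comm (_ ⊗ₜ[k] _) w, map_mul, Module.End.mul_apply,
      tensorAct_tmul_tmul, one_smul]

/-- The map `B ⊗_A M → B ⊗_A (H ⊗ M)`, `b ⊗ m ↦ b₀ ⊗ (S(b₋₁) ⊗ m)`. -/
def cofreeSection (φ : A ⟶ B)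
    (hφ : ∀ a, algebraMap A.carrier B.carrier a = φ.toAlgHom a) :
    B.carrier ⊗[A.carrier] M →+ B.carrier ⊗[A.carrier] (cofreeModule A M).carrier :=
  TensorProduct.liftAddHom ((cofreePairing B M).comp
    (((Algebra.TensorProduct.map (HopfAlgebra.antipodeAlgHom k H) (AlgHom.id k _)).comp
      B.coact).toRingHom.toAddMonoidHom)) (fun a b m => by
    change cofreePairing B M (Algebra.TensorProduct.map (HopfAlgebra.antipodeAlgHom k H)
      (AlgHom.id k _) (B.coact (a • b))) m = cofreePairing B M
        (Algebra.TensorProduct.map (HopfAlgebra.antipodeAlgHom k H)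
      (AlgHom.id k _) (B.coact b)) (a • m)
    have h := DFunLike.congr_fun φ.comm a
    simp only [AlgHom.comp_apply] at h
    rw [Algebra.smul_def, hφ, map_mul, map_mul, ← h, ← AlgHom.comp_apply,
      ← Algebra.TensorProduct.map_comp, AlgHom.comp_id, AlgHom.id_comp]
    generalize Algebra.TensorProduct.map (HopfAlgebra.antipodeAlgHom k H)
      (AlgHom.id k _) (B.coact b) = w
    induction w with
    | zero => simp
    | add x y hx hy => simp only [map_add, mul_add, AddMonoidHom.add_apply, hx, hy]
    | tmul h b =>
      rw [cofreePairing_mul_coact M φ.toAlgHom hφ, antipodeMul_coact, tensorAct_tmul_tmul,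
        one_mul, cofreePairing_tmul]
      rfl)

variable (φ : A ⟶ B) (hφ : ∀ a, algebraMap A.carrier B.carrier a = φ.toAlgHom a)

lemma cofreeSection_tmul (b : B.carrier) (m : M) :
    cofreeSection M φ hφ (b ⊗ₜ m) = cofreePairing B M (Algebra.TensorProduct.map
      (HopfAlgebra.antipodeAlgHom k H) (AlgHom.id k _) (B.coact b)) m := rfl

/-- Since `ε ∘ S = ε`, the composite sends `b ⊗ m` to `ε(b₋₁) b₀ ⊗ m`, which is `b ⊗ m` by the
counit law. -/
lemma lTensor_cofreeCounit_cofreeSection (z : B.carrier ⊗[A.carrier] M) :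
    LinearMap.lTensor B.carrier (cofreeCounit A M) (cofreeSection M φ hφ z) = z := by
  induction z with
  | zero => simp
  | add x y hx hy => simp only [map_add, hx, hy]
  | tmul b m =>
    rw [cofreeSection_tmul]
    have h1 := DFunLike.congr_fun B.counit_coact b
    simp only [AlgHom.comp_apply, AlgHom.id_apply] at h1
    conv_rhs => rw [← h1]
    generalize B.coact b = w
    induction w with
    | zero => simp
    | add x y hx hy => simp only [map_add, add_tmul, AddMonoidHom.add_apply, hx, hy]
    | tmul h b =>
      rw [Algebra.TensorProduct.map_tmul, cofreePairing_tmul, LinearMap.lTensor_tmul]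
      change b ⊗ₜ[A.carrier] (TensorProduct.lid k M (LinearMap.rTensor M
        (Coalgebra.counit (R := k) (A := H)) (HopfAlgebra.antipode k h ⊗ₜ m))) = _
      simp [smul_tmul]

lemma lTensor_cofreeMap_cofreeSection {N : Type u} [AddCommGroup N] [Module k N]
    [Module A.carrier N] [IsScalarTower k A.carrier N] (f : M →ₗ[A.carrier] N)
    (z : B.carrier ⊗[A.carrier] M) :
    LinearMap.lTensor B.carrier (cofreeMap A f) (cofreeSection M φ hφ z) =
      cofreeSection N φ hφ (LinearMap.lTensor B.carrier f z) := by
  induction z with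
  | zero => simp
  | add x y hx hy => simp only [map_add, hx, hy]
  | tmul b m =>
    rw [LinearMap.lTensor_tmul, cofreeSection_tmul, cofreeSection_tmul]
    generalize Algebra.TensorProduct.map (HopfAlgebra.antipodeAlgHom k H)
      (AlgHom.id k _) (B.coact b) = w
    induction w with
    | zero => simp
    | add x y hx hy => simp only [map_add, AddMonoidHom.add_apply, hx, hy]
    | tmul h b => rfl

include φ hφ in
-- The section vanishes as its source is zero. By `mulAntipode_coact`, every `b ⊗ (h ⊗ m)` is a sum
-- of `H`-multiples of values of the section, so it vanishes too.
lemma subsingleton_tensor_cofree [Subsingleton (B.carrier ⊗[A.carrier] M)] :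
    Subsingleton (B.carrier ⊗[A.carrier] (cofreeModule A M).carrier) := by
  refine subsingleton_of_forall_eq 0 fun z => ?_
  have h0 : ∀ b m, cofreePairing (A := A) B M (Algebra.TensorProduct.map
      (HopfAlgebra.antipodeAlgHom k H) (AlgHom.id k _) (B.coact b)) m = 0 := fun b m => by
    rw [← cofreeSection_tmul M φ hφ, Subsingleton.elim (b ⊗ₜ m) (0 : B.carrier ⊗[A.carrier] M),
      map_zero]
  have h1 : ∀ (w : H ⊗[k] B.carrier) (m : M), cofreePairing (A := A) B M
      (mulAntipode B (Algebra.TensorProduct.map (AlgHom.id k H) B.coact w)) m = 0 := fun w m => by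
    induction w with
    | zero => simp
    | add x y hx hy => simp only [map_add, AddMonoidHom.add_apply, hx, hy, add_zero]
    | tmul h b =>
      rw [Algebra.TensorProduct.map_tmul, mulAntipode, Algebra.TensorProduct.lift_tmul]
      refine (cofreePairing_mul_left M _ _ m).trans ?_
      rw [h0, map_zero]
  induction z with
  | zero => rfl
  | add x y hx hy => rw [hx, hy, add_zero]
  | tmul b x =>
    revert x
    intro (x : H ⊗[k] M)
    induction x with
    | zero => exact tmul_zero _ _
    | add x y hx hy => exact (tmul_add _ _ _).trans (by rw [hx, hy, add_zero])
    | tmul h m =>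
      refine (cofreePairing_tmul M h b m).symm.trans ?_
      have : h ⊗ₜ[k] b = (h ⊗ₜ 1) * ((1 : H) ⊗ₜ[k] b) := by simp
      rw [this, cofreePairing_mul_left, ← mulAntipode_coact, h1, map_zero]

end

/-- A morphism in `Alg C` which is faithfully flat on equivariant modules is faithfully flat. -/
lemma faithfullyFlat_of_isFaithfullyFlat (hk : IsField k) {A B : ComodAlg k H} (φ : A ⟶ B)
    (h : IsFaithfullyFlat φ) : φ.toAlgHom.toRingHom.FaithfullyFlat := by
  let : Algebra A.carrier B.carrier := φ.toAlgHom.toRingHom.toAlgebra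
  have hφ : ∀ a, algebraMap A.carrier B.carrier a = φ.toAlgHom a := fun _ => rfl
  have : IsScalarTower k A.carrier B.carrier := IsScalarTower.of_algebraMap_eq fun r => by
    rw [hφ, AlgHom.commutes]
  let := hk.toField
  -- The only use of the field hypothesis: `H ⊗ -` must preserve injections.
  have hflatH : Module.Flat k H := by
    have : @Module.Flat k H (Field.toSemifield.toCommSemiring) _ _ := inferInstance
    exact this
  obtain ⟨hflat, hfaith⟩ := h
  change Module.FaithfullyFlat A.carrier B.carrier
  rw [Module.FaithfullyFlat.iff_flat_and_lTensor_reflects_triviality]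
  constructor
  · rw [Module.Flat.iff_lTensor_preserves_injective_linearMap]
    intro M N _ _ _ _ f hf
    let : Module k M := Module.compHom M (algebraMap k A.carrier)
    let : Module k N := Module.compHom N (algebraMap k A.carrier)
    have : IsScalarTower k A.carrier M := .of_algebraMap_smul fun _ _ => rfl
    have : IsScalarTower k A.carrier N := .of_algebraMap_smul fun _ _ => rfl
    have hinj : Function.Injective (cofreeMap A f) :=
      Module.Flat.lTensor_preserves_injective_linearMap (M := H) (f.restrictScalars k) hf
    -- Injectivity of `cofreeMap A f` is phrased as exactness after the zero map, so that
    -- equivariant flatness applies. The choice of source for the zero map is immaterial.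
    have hex := hflat (cofreeModule A M) (cofreeModule A M) (cofreeModule A N) 0 (cofreeMap A f)
      (by simp [EquivModule.IsEquivariant]) (cofreeMap_isEquivariant A f)
      (fun x => by simp [map_eq_zero_iff _ hinj, eq_comm])
    rw [injective_iff_map_eq_zero]
    intro z hz
    have h1 := lTensor_cofreeMap_cofreeSection M φ hφ f z
    rw [hz, map_zero] at h1
    obtain ⟨y, hy⟩ := (hex _).1 h1
    rw [LinearMap.lTensor_zero, LinearMap.zero_apply] at hy
    rw [← lTensor_cofreeCounit_cofreeSection M φ hφ z, ← hy, map_zero]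
  · intro M _ _ _
    let : Module k M := Module.compHom M (algebraMap k A.carrier)
    have : IsScalarTower k A.carrier M := .of_algebraMap_smul fun _ _ => rfl
    have := subsingleton_tensor_cofree M φ hφ
    -- Identity and zero agree after `B ⊗_A -`, hence already on `H ⊗ M`. Then `M` is zero because
    -- `ε ⊗ M` is surjective.
    have h0 := hfaith (cofreeModule A M) (cofreeModule A M) LinearMap.id 0
      (by simp [EquivModule.IsEquivariant])
      (by simp [EquivModule.IsEquivariant])
      (LinearMap.ext fun _ => Subsingleton.elim _ _)
    refine subsingleton_of_forall_eq 0 fun m => ?_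
    have h1 : cofreeCounit A M (cofreeMk A 1 m) = m := by
      change TensorProduct.lid k M (LinearMap.rTensor M
        (Coalgebra.counit (R := k) (A := H)) (1 ⊗ₜ m)) = m
      simp
    have h2 := DFunLike.congr_fun h0 (cofreeMk A 1 m)
    rw [LinearMap.id_apply, LinearMap.zero_apply] at h2
    rw [← h1, h2, map_zero]

end FaithfullyFlat

end

end EquivGeom

namespace EquivGeom

noncomputable section

/-! ### Cofree comodule algebras. -/

section CofreeAlgebra

open TensorProduct

variable {k : CommRingCat.{u}} {H : Type u} [CommRing H] [HopfAlgebra k H]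

variable (H) in
/-- The coaction `h ⊗ r ↦ Δ(h) ⊗ r` on `H ⊗ R`. -/
def cofreeAlgCoact (R : Type u) [CommRing R] [Algebra k R] :
    H ⊗[k] R →ₐ[k] H ⊗[k] (H ⊗[k] R) :=
  (Algebra.TensorProduct.assoc k k k H H R).toAlgHom.comp
    (Algebra.TensorProduct.map (Bialgebra.comulAlgHom k H) (AlgHom.id k R))

variable (H) in
/-- The cofree comodule algebra `H ⊗ R`, the coordinate algebra of the free `G`-scheme
`G × Spec R`. -/
def cofreeAlg (R : Type u) [CommRing R] [Algebra k R] : ComodAlg k H where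
  carrier := H ⊗[k] R
  coact := cofreeAlgCoact H R
  counit_coact := AlgHom.ext fun x => DFunLike.congr_fun (cofreeCoact_counit R) x
  coassoc := AlgHom.ext fun x => DFunLike.congr_fun (cofreeCoact_coassoc R) x

variable (H) in
/-- The counit `H ⊗ R → R` of the adjunction between forgetful and cofree functors. -/
def cofreeAlgCounit (R : Type u) [CommRing R] [Algebra k R] :
    H ⊗[k] R →ₐ[k] R :=
  (Algebra.TensorProduct.lid k R).toAlgHom.comp
    (Algebra.TensorProduct.map (Bialgebra.counitAlgHom k H) (AlgHom.id k R))

/-- The right counit law `(id ⊗ ε) Δ = id`. Geometrically, translating the unit section by `g` gives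
`g • (1, r) = (g, r)`. -/
lemma map_cofreeAlgCounit_comp_coact (R : Type u) [CommRing R] [Algebra k R] :
    (Algebra.TensorProduct.map (AlgHom.id k H) (cofreeAlgCounit H R)).comp
      (cofreeAlgCoact H R) = AlgHom.id k (H ⊗[k] R) := by
  refine Algebra.TensorProduct.ext' fun h r => ?_
  have key : ∀ d : H ⊗[k] H, Algebra.TensorProduct.map (AlgHom.id k H) (cofreeAlgCounit H R)
      (Algebra.TensorProduct.assoc k k k H H R (d ⊗ₜ r)) =
      TensorProduct.rid k H (LinearMap.lTensor H (Coalgebra.counit (R := k) (A := H)) d) ⊗ₜ r := by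
    intro d
    induction d with
    | zero => simp
    | add x y hx hy => simp only [map_add, add_tmul, hx, hy]
    | tmul x y =>
      change x ⊗ₜ[k] (Algebra.TensorProduct.lid k R (Algebra.TensorProduct.map
        (Bialgebra.counitAlgHom k H) (AlgHom.id k R) (y ⊗ₜ r))) = _
      simp [smul_tmul]
  refine (key (Coalgebra.comul (R := k) h)).trans ?_
  simp

/-- The morphism `A ⟶ H ⊗ R` in `Alg C` corresponding to a homomorphism of algebras `A → R`. -/
def cofreeLift (A : ComodAlg k H) {R : Type u} [CommRing R] [Algebra k R]
    (φ : A.carrier →ₐ[k] R) : A ⟶ cofreeAlg H R where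
  toAlgHom := (Algebra.TensorProduct.map (AlgHom.id k H) φ).comp A.coact
  comm := AlgHom.ext fun a => by
    have h := DFunLike.congr_fun A.coassoc a
    have e1 : ∀ v : H ⊗[k] A.carrier, Algebra.TensorProduct.map (AlgHom.id k H)
        ((Algebra.TensorProduct.map (AlgHom.id k H) φ).comp A.coact) v =
        Algebra.TensorProduct.map (AlgHom.id k H) (Algebra.TensorProduct.map (AlgHom.id k H) φ)
          (Algebra.TensorProduct.map (AlgHom.id k H) A.coact v) := fun v => by
      rw [← AlgHom.comp_apply (Algebra.TensorProduct.map (AlgHom.id k H) _),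
        ← Algebra.TensorProduct.map_id_comp]
    have e2 : ∀ v : H ⊗[k] A.carrier, cofreeAlgCoact H R
        (Algebra.TensorProduct.map (AlgHom.id k H) φ v) =
        Algebra.TensorProduct.map (AlgHom.id k H) (Algebra.TensorProduct.map (AlgHom.id k H) φ)
          (Algebra.TensorProduct.assoc k k k H H A.carrier (Algebra.TensorProduct.map
            (Bialgebra.comulAlgHom k H) (AlgHom.id k A.carrier) v)) := fun v => by
      induction v with
      | zero => simp
      | add x y hx hy => simp only [map_add, hx, hy]
      | tmul x y =>
        change Algebra.TensorProduct.assoc k k k H H R (Coalgebra.comul (R := k) x ⊗ₜ φ y) =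
          Algebra.TensorProduct.map (AlgHom.id k H) (Algebra.TensorProduct.map (AlgHom.id k H) φ)
          (Algebra.TensorProduct.assoc k k k H H A.carrier (Coalgebra.comul (R := k) x ⊗ₜ y))
        generalize Coalgebra.comul (R := k) x = d
        induction d with
        | zero => simp
        | add x y hx hy => simp only [map_add, add_tmul, hx, hy]
        | tmul x y => simp
    exact (e1 (A.coact a)).trans (((congrArg _ h).symm).trans (e2 (A.coact a)).symm)

lemma cofreeAlgCounit_comp_lift (A : ComodAlg k H) {R : Type u} [CommRing R] [Algebra k R]
    (φ : A.carrier →ₐ[k] R) :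
    (cofreeAlgCounit H R).comp (cofreeLift A φ).toAlgHom = φ := by
  refine AlgHom.ext fun a => ?_
  have h1 := DFunLike.congr_fun A.counit_coact a
  refine Eq.trans ?_ (congrArg φ h1)
  change cofreeAlgCounit H R (Algebra.TensorProduct.map (AlgHom.id k H) φ (A.coact a)) =
    φ (Algebra.TensorProduct.lid k A.carrier (Algebra.TensorProduct.map
      (Bialgebra.counitAlgHom k H) (AlgHom.id k A.carrier) (A.coact a)))
  generalize A.coact a = v
  induction v with
  | zero => simp
  | add x y hx hy => simp only [map_add, hx, hy]
  | tmul x y =>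
    change Algebra.TensorProduct.lid k R (Algebra.TensorProduct.map (Bialgebra.counitAlgHom k H)
      (AlgHom.id k R) (x ⊗ₜ φ y)) = _
    simp

lemma cofreeLift_comp {A B : ComodAlg k H} (f : A ⟶ B) {R : Type u} [CommRing R] [Algebra k R]
    (φ : B.carrier →ₐ[k] R) :
    f ≫ cofreeLift B φ = cofreeLift A (φ.comp f.toAlgHom) := by
  refine ComodAlg.Hom.ext ?_
  change ((Algebra.TensorProduct.map (AlgHom.id k H) φ).comp B.coact).comp f.toAlgHom =
    (Algebra.TensorProduct.map (AlgHom.id k H) (φ.comp f.toAlgHom)).comp A.coact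
  rw [AlgHom.comp_assoc, ← f.comm, ← AlgHom.comp_assoc, ← Algebra.TensorProduct.map_id_comp]

end CofreeAlgebra

end

end EquivGeom

namespace EquivGeom

noncomputable section

/-! ### The free `G`-scheme `G × Spec R` and its equivariant morphisms. -/

section FreeScheme

open MonoidalCategory Opposite TensorProduct MonObj

variable {k : CommRingCat.{u}} {H : Type u} [CommRing H] [HopfAlgebra k H]

lemma lax_free_smul {C D : Type*} [Category C] [Category D] [MonoidalCategory C]
    [MonoidalCategory D] (F : C ⥤ D) [F.LaxMonoidal] {M X : C} (m : M ⊗ M ⟶ M) :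
    F.obj M ◁ Functor.LaxMonoidal.μ F M X ≫ Functor.LaxMonoidal.μ F M (M ⊗ X) ≫
      F.map ((α_ M M X).inv ≫ m ▷ X) =
    (α_ _ _ _).inv ≫ (Functor.LaxMonoidal.μ F M M ≫ F.map m) ▷ F.obj X ≫
      Functor.LaxMonoidal.μ F M X := by
  rw [Iso.eq_inv_comp, comp_whiskerRight, Category.assoc, Functor.LaxMonoidal.μ_natural_left,
    ← Functor.LaxMonoidal.associativity_assoc, ← F.map_comp, Iso.hom_inv_id_assoc]

/-- The morphism of affine `k`-schemes corresponding to a homomorphism of algebras. -/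
abbrev specMap {R R' : Type u} [CommRing R] [Algebra k R] [CommRing R'] [Algebra k R']
    (φ : R →ₐ[k] R') : specAlg k R' ⟶ specAlg k R :=
  (algSpec k).map (CommAlgCat.ofHom φ).op

lemma specMap_comp {R R' R'' : Type u} [CommRing R] [Algebra k R] [CommRing R'] [Algebra k R']
    [CommRing R''] [Algebra k R''] (φ : R →ₐ[k] R') (ψ : R' →ₐ[k] R'') :
    specMap (ψ.comp φ) = specMap ψ ≫ specMap φ := by
  rw [specMap, specMap, specMap, ← Functor.map_comp]; rfl

lemma specMap_id (R : Type u) [CommRing R] [Algebra k R] :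
    specMap (AlgHom.id k R) = 𝟙 (specAlg k R) :=
  (algSpec k).map_id _

lemma specMap_surjective {R R' : Type u} [CommRing R] [Algebra k R] [CommRing R'] [Algebra k R']
    (f : specAlg k R' ⟶ specAlg k R) : ∃ φ : R →ₐ[k] R', specMap φ = f := by
  obtain ⟨g, rfl⟩ := (algSpec k).map_surjective f
  exact ⟨g.unop.hom, rfl⟩

/-- The action of the group scheme `Spec H` on `X`. -/
abbrev act (X : Over (Spec k)) [ModObj (specAlg k H) X] : specAlg k H ⊗ X ⟶ X :=
  γ[specAlg k H, X]

/-- Equivariance of a morphism from `Spec A`, for `A` in `Alg C`. -/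
def Equivariant {X : Over (Spec k)} [ModObj (specAlg k H) X] {A : ComodAlg k H}
    (f : specAlg k A.carrier ⟶ X) : Prop :=
  actionMap A ≫ f = specAlg k H ◁ f ≫ act X

lemma Equivariant.specMap_comp {X : Over (Spec k)} [ModObj (specAlg k H) X] {A B : ComodAlg k H}
    {f : specAlg k A.carrier ⟶ X} (hf : Equivariant f) (φ : A ⟶ B) :
    Equivariant (specMap φ.toAlgHom ≫ f) := by
  change actionMap B ≫ specMap φ.toAlgHom ≫ f = _
  rw [← Category.assoc, isModHom_spec φ, Category.assoc, hf, whiskerLeft_comp, Category.assoc]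

/-- The isomorphism `Spec (H ⊗ R) ≅ Spec H × Spec R`. -/
def cofreeIso (H : Type u) [CommRing H] [HopfAlgebra k H] (R : Type u) [CommRing R] [Algebra k R] :
    specAlg k H ⊗ specAlg k R ≅ specAlg k (cofreeAlg (k := k) H R).carrier :=
  Functor.Monoidal.μIso (algSpec k) (op (CommAlgCat.of k H)) (op (CommAlgCat.of k R))

/-- Identifies the action on `Spec (H ⊗ R)` with left translation on the first factor of `G × Spec
R`, since the coaction is `Δ ⊗ id`. -/
lemma whiskerLeft_cofreeIso_actionMap (R : Type u) [CommRing R] [Algebra k R] :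
    specAlg k H ◁ (cofreeIso H R).hom ≫ actionMap (cofreeAlg H R) =
      (α_ _ _ _).inv ≫ μ[specAlg k H] ▷ specAlg k R ≫ (cofreeIso H R).hom := by
  rw [specAlg_mul]
  exact lax_free_smul (algSpec k) (M := op (CommAlgCat.of k H)) (X := op (CommAlgCat.of k R))
    (CommAlgCat.ofHom (Bialgebra.comulAlgHom k H)).op

/-- The unit section `Spec R ⟶ G × Spec R`. -/
def unitSection (H : Type u) [CommRing H] [HopfAlgebra k H] (R : Type u) [CommRing R]
    [Algebra k R] : specAlg k R ⟶ specAlg k (cofreeAlg (k := k) H R).carrier :=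
  specMap (cofreeAlgCounit H R)

lemma lax_unit {C D : Type*} [Category C] [Category D] [MonoidalCategory C]
    [MonoidalCategory D] (F : C ⥤ D) [F.LaxMonoidal] {M X : C} (e : 𝟙_ C ⟶ M) :
    F.map ((λ_ X).inv ≫ e ▷ X) =
      (λ_ _).inv ≫ (Functor.LaxMonoidal.ε F ≫ F.map e) ▷ F.obj X ≫ Functor.LaxMonoidal.μ F M X := by
  rw [Iso.eq_inv_comp, comp_whiskerRight, Category.assoc, Functor.LaxMonoidal.μ_natural_left,
    Functor.LaxMonoidal.left_unitality, Category.assoc, Category.assoc, ← F.map_comp,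
    Iso.hom_inv_id_assoc]

lemma unitSection_eq (R : Type u) [CommRing R] [Algebra k R] :
    unitSection (k := k) H R =
      (λ_ _).inv ≫ η[specAlg k H] ▷ specAlg k R ≫ (cofreeIso H R).hom := by
  rw [specAlg_one]
  exact lax_unit (algSpec k) (M := op (CommAlgCat.of k H)) (X := op (CommAlgCat.of k R))
    (CommAlgCat.ofHom (Bialgebra.counitAlgHom k H)).op

lemma whiskerLeft_unitSection_actionMap (R : Type u) [CommRing R] [Algebra k R] :
    specAlg k H ◁ unitSection H R ≫ actionMap (cofreeAlg H R) =
      (cofreeIso (k := k) H R).hom := by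
  have h1 := Functor.LaxMonoidal.μ_natural_right (algSpec k) (op (CommAlgCat.of k H))
    (CommAlgCat.ofHom (cofreeAlgCounit H R)).op
  change _ ◁ (algSpec k).map (CommAlgCat.ofHom (cofreeAlgCounit H R)).op ≫
    Functor.LaxMonoidal.μ (algSpec k) (op (CommAlgCat.of k H))
      (op (CommAlgCat.of k (H ⊗[k] R))) ≫
      (algSpec k).map (CommAlgCat.ofHom (cofreeAlgCoact H R)).op = _
  rw [← Category.assoc, h1, Category.assoc, ← Functor.map_comp]
  refine Eq.trans ?_ (Category.comp_id _)
  refine congrArg _ (Eq.trans (congrArg _ ?_) ((algSpec k).map_id _))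
  apply Quiver.Hom.unop_inj
  exact CommAlgCat.hom_ext (map_cofreeAlgCounit_comp_coact (H := H) R)

lemma unitSection_comp_cofreeLift (A : ComodAlg k H) {R : Type u} [CommRing R]
    [Algebra k R] (φ : A.carrier →ₐ[k] R) :
    unitSection H R ≫ specMap (cofreeLift A φ).toAlgHom = specMap φ :=
  (specMap_comp _ _).symm.trans (congrArg _ (cofreeAlgCounit_comp_lift A φ))

/-- Naturality of the unit section in `R`: the lift that occurs here is `id ⊗ φ`, presented as a
`cofreeLift` so that the universal property applies. -/
lemma unitSection_comp_specMap {R R' : Type u} [CommRing R] [Algebra k R] [CommRing R']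
    [Algebra k R'] (φ : R →ₐ[k] R') :
    unitSection H R' ≫ specMap (cofreeLift (cofreeAlg (k := k) H R)
      (φ.comp (cofreeAlgCounit H R))).toAlgHom = specMap φ ≫ unitSection H R :=
  (unitSection_comp_cofreeLift _ _).trans (specMap_comp (cofreeAlgCounit H R) φ)

section Extend
variable {X Y : Over (Spec k)} [ModObj (specAlg k H) X] [ModObj (specAlg k H) Y]
variable {R : Type u} [CommRing R] [Algebra k R]

/-- The extension of an `R`-point of `X` to an equivariant morphism `G × Spec R ⟶ X`. -/
def extend (x : specAlg k R ⟶ X) : specAlg k (cofreeAlg (k := k) H R).carrier ⟶ X :=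
  (cofreeIso H R).inv ≫ specAlg k H ◁ x ≫ act X

/-- Associativity of the action, `(g g') • x = g • (g' • x)`, checked after precomposing with the
isomorphism from `G × (G × Spec R)`. -/
lemma equivariant_extend (x : specAlg k R ⟶ X) : Equivariant (extend (H := H) x) := by
  have h : specAlg k H ◁ (cofreeIso H R).hom ≫ actionMap (cofreeAlg H R) ≫ extend (H := H) x =
      specAlg k H ◁ (cofreeIso H R).hom ≫ specAlg k H ◁ extend (H := H) x ≫ act X := by
    rw [← Category.assoc, whiskerLeft_cofreeIso_actionMap, ← whiskerLeft_comp_assoc]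
    simp only [extend, Category.assoc, Iso.hom_inv_id_assoc]
    rw [← whisker_exchange_assoc, act, ModObj.mul_smul_self]
    simp
  rwa [cancel_epi] at h

lemma unitSection_comp_extend (x : specAlg k R ⟶ X) :
    unitSection H R ≫ extend (H := H) x = x := by
  rw [unitSection_eq]
  simp only [extend, Category.assoc, Iso.hom_inv_id_assoc]
  rw [← whisker_exchange_assoc, act, ModObj.one_smul_self]
  simp

/-- Equivariance forces `f (g, r) = g • f (1, r)`. -/
lemma extend_unitSection_comp {f : specAlg k (cofreeAlg (k := k) H R).carrier ⟶ X}
    (hf : Equivariant f) : extend (unitSection H R ≫ f) = f := by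
  rw [extend, whiskerLeft_comp_assoc, ← hf, ← Category.assoc (_ ◁ _),
    whiskerLeft_unitSection_actionMap, Iso.inv_hom_id_assoc]

lemma Equivariant.ext {f g : specAlg k (cofreeAlg (k := k) H R).carrier ⟶ X}
    (hf : Equivariant f) (hg : Equivariant g) (h : unitSection H R ≫ f = unitSection H R ≫ g) :
    f = g := by
  rw [← extend_unitSection_comp hf, h, extend_unitSection_comp hg]

lemma Equivariant.specMap_cofreeLift {A : ComodAlg k H} {f : specAlg k A.carrier ⟶ X}
    (hf : Equivariant f) (φ : A.carrier →ₐ[k] R) :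
    specMap (cofreeLift A φ).toAlgHom ≫ f = extend (specMap φ ≫ f) := by
  refine (hf.specMap_comp _).ext (equivariant_extend _) ?_
  rw [unitSection_comp_extend, ← Category.assoc, unitSection_comp_cofreeLift]

end Extend

end FreeScheme

end

end EquivGeom

namespace EquivGeom

noncomputable section

/-! ### Affine points, gluing, and fpqc covers of `k`-schemes. -/

section Covers

variable {k : CommRingCat.{u}}

/-- The fpqc topology on `k`-schemes. -/
abbrev overTopology (k : CommRingCat.{u}) : GrothendieckTopology (Over (Spec k)) :=
  Scheme.fpqcTopology.over (Spec k)

lemma isSheaf_yoneda_over (Y : Over (Spec k)) :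
    Presieve.IsSheaf (overTopology k) (yoneda.obj Y) :=
  GrothendieckTopology.Subcanonical.isSheaf_of_isRepresentable _

lemma hom_ext_of_mem {X Y : Over (Spec k)} {S : Sieve X} (hS : S ∈ overTopology k X)
    {f g : X ⟶ Y} (h : ∀ (Z : Over (Spec k)) (p : Z ⟶ X), S p → p ≫ f = p ≫ g) : f = g :=
  (isSheaf_yoneda_over Y S hS).isSeparatedFor.ext (fun Z p hp => h Z p hp)

/-- The sieve of morphisms factoring through an affine `k`-scheme. -/
def affineSieve (X : Over (Spec k)) : Sieve X where
  arrows Z f := ∃ (R : CommAlgCat.{u} k) (q : Z ⟶ specAlg k R) (x : specAlg k R ⟶ X), q ≫ x = f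
  downward_closed := by
    rintro Z W _ ⟨R, q, x, rfl⟩ g
    exact ⟨R, g ≫ q, x, by simp⟩

lemma exists_homMk_affine {X : Over (Spec k)} {R : CommRingCat.{u}} (j : Spec R ⟶ X.left) :
    ∃ (R' : CommAlgCat.{u} k) (e : Spec R ⟶ (specAlg k R').left) (x : specAlg k R' ⟶ X),
      e ≫ x.left = j := by
  let φ : k ⟶ R := Spec.preimage (j ≫ X.hom)
  let : Algebra k R := φ.hom.toAlgebra
  refine ⟨CommAlgCat.of k R, 𝟙 _, Over.homMk j ?_, Category.id_comp _⟩
  exact (Spec.map_preimage (j ≫ X.hom)).symm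

lemma affineSieve_mem (X : Over (Spec k)) : affineSieve X ∈ overTopology k X := by
  rw [GrothendieckTopology.mem_over_iff]
  refine GrothendieckTopology.superset_covering _ ?_
    (Scheme.zariskiTopology_le_fpqcTopology _ X.left.affineCover.mem_grothendieckTopology)
  rw [Sieve.ofArrows, Sieve.generate_le_iff]
  rintro _ _ ⟨i⟩
  obtain ⟨R', e, x, hx⟩ := exists_homMk_affine (X := X) (X.left.affineCover.f i)
  refine (Sieve.overEquiv_iff _ _).2 ⟨R', Over.homMk e ?_, x, Over.OverMorphism.ext hx⟩
  change _ = X.left.affineCover.f i ≫ X.hom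
  rw [← Over.w x, ← hx]
  exact (Category.assoc _ _ _).symm

/-- Morphisms from affine `k`-schemes generate a covering sieve, so they separate morphisms out of
`X`. -/
lemma hom_ext_affine {X Y : Over (Spec k)} {f g : X ⟶ Y}
    (h : ∀ (R : CommAlgCat.{u} k) (x : specAlg k R ⟶ X), x ≫ f = x ≫ g) : f = g := by
  refine hom_ext_of_mem (affineSieve_mem X) ?_
  rintro Z _ ⟨R, q, x, rfl⟩
  simp [h]

/-- A map between functors of points on affine `k`-schemes comes from a morphism. -/
lemma exists_hom_of_affine_points {X Y : Over (Spec k)}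
    (N : ∀ R : CommAlgCat.{u} k, (specAlg k R ⟶ X) → (specAlg k R ⟶ Y))
    (hN : ∀ (R R' : CommAlgCat.{u} k) (q : specAlg k R' ⟶ specAlg k R) (x : specAlg k R ⟶ X),
      N R' (q ≫ x) = q ≫ N R x) :
    ∃ f : X ⟶ Y, ∀ (R : CommAlgCat.{u} k) (x : specAlg k R ⟶ X), x ≫ f = N R x := by
  -- The local value depends only on the composite `q ≫ x`, not on the factorization. On affine
  -- points of `Z` this is naturality of `N`, and affine points suffice.
  have hwd : ∀ (Z : Over (Spec k)) (R R' : CommAlgCat.{u} k) (q : Z ⟶ specAlg k R)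
      (q' : Z ⟶ specAlg k R') (x : specAlg k R ⟶ X) (x' : specAlg k R' ⟶ X),
      q ≫ x = q' ≫ x' → q ≫ N R x = q' ≫ N R' x' := by
    intro Z R R' q q' x x' h
    refine hom_ext_affine fun T z => ?_
    rw [← Category.assoc, ← Category.assoc, ← hN, ← hN, Category.assoc, h, Category.assoc]
  choose R q x hqx using fun (Z : Over (Spec k)) (p : Z ⟶ X) (hp : affineSieve X p) => hp
  let fam : Presieve.FamilyOfElements (yoneda.obj Y) (affineSieve X).arrows :=
    fun Z p hp => q Z p hp ≫ N _ (x Z p hp)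
  have hfam : fam.Compatible := by
    intro Z₁ Z₂ Z g₁ g₂ p₁ p₂ h₁ h₂ h
    change g₁ ≫ q Z₁ p₁ h₁ ≫ _ = g₂ ≫ q Z₂ p₂ h₂ ≫ _
    rw [← Category.assoc, ← Category.assoc]
    apply hwd
    rw [Category.assoc, Category.assoc, hqx, hqx, h]
  obtain ⟨f, hf, -⟩ := isSheaf_yoneda_over Y _ (affineSieve_mem X) fam hfam
  refine ⟨f, fun T y => ?_⟩
  have hy : affineSieve X y := ⟨T, 𝟙 _, y, by simp⟩
  refine (hf y hy).trans ?_
  refine (hwd _ _ T _ (𝟙 _) _ y ?_).trans (Category.id_comp _)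
  rw [hqx, Category.id_comp]

/-- Faithful flatness of the product gives flatness of each factor and joint surjectivity on
spectra; quasi-compactness follows from finiteness and affineness. -/
lemma ofArrows_mem_overTopology {n : ℕ} {A : Type u} [CommRing A] [Algebra k A]
    {B : Fin n → Type u} [∀ i, CommRing (B i)] [∀ i, Algebra k (B i)] (f : ∀ i, A →ₐ[k] B i)
    (hf : (AlgHom.pi f).toRingHom.FaithfullyFlat) :
    Sieve.ofArrows (fun i => specAlg k (B i)) (fun i => specMap (f i)) ∈
      overTopology k (specAlg k A) := by
  rw [GrothendieckTopology.mem_over_iff, Sieve.overEquiv_ofArrows]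
  refine Precoverage.generate_mem_toGrothendieck ?_
  have hflat : ∀ i, Flat (specMap (f i)).left := fun i => by
    change Flat (Spec.map (CommRingCat.ofHom (f i).toRingHom))
    rw [HasRingHomProperty.Spec_iff (P := @Flat)]
    let : Algebra A (∀ i, B i) := (AlgHom.pi f).toRingHom.toAlgebra
    let : Algebra A (B i) := (f i).toRingHom.toAlgebra
    have : Module.Flat A (∀ i, B i) := hf.flat
    change Module.Flat A (B i)
    -- Each `B i` is a direct summand of the product as an `A`-module.
    refine Module.Flat.of_retract
      (i := { toFun := Pi.single i, map_add' := Pi.single_add i, map_smul' := fun a b => ?_ })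
      (r := { toFun := fun b => b i, map_add' := fun _ _ => rfl, map_smul' := fun _ _ => rfl }) ?_
    · funext j
      change _ = f j a * Pi.single (M := B) i b j
      by_cases h : j = i
      · subst h
        change Pi.single (M := B) j (f j a * b) j = _
        simp
      · simp [h]
    · exact LinearMap.ext fun b => Pi.single_eq_same (M := B) i b
  have hsurj : ∀ x : (specAlg k A).left, ∃ i, x ∈ Set.range (specMap (f i)).left := fun x => by
    obtain ⟨y, hy⟩ := (RingHom.FaithfullyFlat.iff_flat_and_comap_surjective.1 hf).2 x
    -- A prime of a finite product comes from exactly one factor.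
    obtain ⟨i, q, rfl⟩ := PrimeSpectrum.exists_comap_evalRingHom_eq y
    exact ⟨i, q, hy⟩
  have hqc : ∀ i, QuasiCompact (specMap (f i)).left := fun i =>
    inferInstanceAs (QuasiCompact (Spec.map (CommRingCat.ofHom (f i).toRingHom)))
  let E : PreZeroHypercover (specAlg k A).left :=
    { I₀ := Fin n, X := fun i => (specAlg k (B i)).left, f := fun i => (specMap (f i)).left }
  have : Finite E.I₀ := inferInstanceAs (Finite (Fin n))
  exact ⟨(Scheme.presieve₀_mem_qcPrecoverage_iff (E := E)).2
    ⟨fun {U} hU => .of_finite_of_isSpectralMap (fun i => Scheme.Hom.isSpectralMap (E.f i))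
      (fun x _ => hsurj x) U.2 hU.isCompact⟩,
    Scheme.ofArrows_mem_precoverage_iff _ |>.2 ⟨hsurj, hflat⟩⟩

end Covers

end

end EquivGeom

namespace EquivGeom

noncomputable section

open MonoidalCategory Opposite MonObj

/-! ### Equivariant points determine morphisms and satisfy descent. -/

section EquivariantPoints

variable {k : CommRingCat.{u}} {H : Type u} [CommRing H] [HopfAlgebra k H]

/-- The equivariant morphisms `Spec A ⟶ X`. -/
abbrev EquivHom (A : ComodAlg k H) (X : Over (Spec k)) [ModObj (specAlg k H) X] : Type u :=
  {f : specAlg k A.carrier ⟶ X // Equivariant f}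

variable {X : Over (Spec k)} [ModObj (specAlg k H) X]

/-- Precomposition of an equivariant morphism with `Spec φ`. -/
def EquivHom.precomp {A B : ComodAlg k H} (φ : A ⟶ B) (f : EquivHom A X) : EquivHom B X :=
  ⟨specMap φ.toAlgHom ≫ f.1, f.2.specMap_comp φ⟩

/-- The equivariant morphism `G × Spec R ⟶ X` extending an `R`-point. -/
def EquivHom.ofPoint (H : Type u) [CommRing H] [HopfAlgebra k H] {X : Over (Spec k)}
    [ModObj (specAlg k H) X] {R : Type u} [CommRing R] [Algebra k R]
    (x : specAlg k R ⟶ X) : EquivHom (cofreeAlg (k := k) H R) X :=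
  ⟨extend x, equivariant_extend x⟩

lemma EquivHom.ofPoint_specMap_comp {R R' : Type u} [CommRing R] [Algebra k R] [CommRing R']
    [Algebra k R'] (φ : R →ₐ[k] R') (x : specAlg k R ⟶ X) :
    ofPoint H (specMap φ ≫ x) = precomp (cofreeLift (cofreeAlg (k := k) H R)
      (φ.comp (cofreeAlgCounit H R))) (ofPoint H x) := by
  refine Subtype.ext ((ofPoint H _).2.ext (precomp _ _).2 ?_)
  change unitSection H R' ≫ extend _ = unitSection H R' ≫ specMap _ ≫ extend x
  rw [unitSection_comp_extend, ← Category.assoc, unitSection_comp_specMap, Category.assoc,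
    unitSection_comp_extend]

/-- The lift of the identity is the coaction of `A`, so the right side is `(g, a) ↦ f (g • a)` and
the left side is `(g, a) ↦ g • f a`. -/
lemma EquivHom.ofPoint_val {A : ComodAlg k H} (f : EquivHom A X) :
    ofPoint H f.1 = precomp (cofreeLift A (AlgHom.id k A.carrier)) f := by
  refine Subtype.ext ?_
  change extend f.1 = specMap _ ≫ f.1
  rw [f.2.specMap_cofreeLift, specMap_id, Category.id_comp]

lemma hom_ext_of_equivariant_points {Y : Over (Spec k)} {F F' : X ⟶ Y}
    (h : ∀ (A : ComodAlg k H) (f : EquivHom A X), f.1 ≫ F = f.1 ≫ F') : F = F' := by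
  refine hom_ext_affine fun R x => ?_
  have hx := h _ (EquivHom.ofPoint H x)
  rw [← unitSection_comp_extend (H := H) x, Category.assoc, Category.assoc]
  exact congrArg _ hx

variable {Y : Over (Spec k)} [ModObj (specAlg k H) Y]

/-- The value on `R`-points of a transformation of the functors of equivariant points. -/
def pointsMap (θ : ∀ A : ComodAlg k H, EquivHom A X → EquivHom A Y) {R : Type u} [CommRing R]
    [Algebra k R] (x : specAlg k R ⟶ X) : specAlg k R ⟶ Y :=
  unitSection H R ≫ (θ _ (EquivHom.ofPoint H x)).1

variable (θ : ∀ A : ComodAlg k H, EquivHom A X → EquivHom A Y)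
  (hθ : ∀ (A B : ComodAlg k H) (φ : A ⟶ B) (f : EquivHom A X),
    θ B (f.precomp φ) = (θ A f).precomp φ)

include hθ in
lemma pointsMap_specMap_comp {R R' : Type u} [CommRing R] [Algebra k R] [CommRing R']
    [Algebra k R'] (φ : R →ₐ[k] R') (x : specAlg k R ⟶ X) :
    pointsMap θ (specMap φ ≫ x) = specMap φ ≫ pointsMap θ x := by
  rw [pointsMap, EquivHom.ofPoint_specMap_comp, hθ]
  change unitSection H R' ≫ specMap _ ≫ _ = _
  rw [← Category.assoc, unitSection_comp_specMap, Category.assoc]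
  rfl

include hθ in
lemma pointsMap_comp {R R' : Type u} [CommRing R] [Algebra k R] [CommRing R']
    [Algebra k R'] (q : specAlg k R' ⟶ specAlg k R) (x : specAlg k R ⟶ X) :
    pointsMap θ (q ≫ x) = q ≫ pointsMap θ x := by
  obtain ⟨φ, rfl⟩ := specMap_surjective q
  exact pointsMap_specMap_comp θ hθ φ x

include hθ in
-- Naturality of `θ` along the coaction `A ⟶ H ⊗ A`, whose spectrum restricts to the identity on the
-- unit section.
lemma pointsMap_val {A : ComodAlg k H} (f : EquivHom A X) : pointsMap θ f.1 = (θ A f).1 := by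
  rw [pointsMap, EquivHom.ofPoint_val, hθ]
  change unitSection H _ ≫ specMap _ ≫ _ = _
  rw [← Category.assoc, unitSection_comp_cofreeLift, specMap_id, Category.id_comp]

/-- The value of the action of `G` at an `R`-point `(g, x)` of `G × X`. -/
lemma comp_act {R : Type u} [CommRing R] [Algebra k R] (g : specAlg k R ⟶ specAlg k H)
    (x : specAlg k R ⟶ X) :
    CartesianMonoidalCategory.lift g x ≫ act X =
      CartesianMonoidalCategory.lift g (𝟙 _) ≫ (cofreeIso H R).hom ≫ extend x := by
  simp [extend]

include hθ in
lemma exists_hom_of_equivariant_points :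
    ∃ F : X ⟶ Y, act (H := H) X ≫ F = specAlg k H ◁ F ≫ act Y ∧
      ∀ (A : ComodAlg k H) (f : EquivHom A X), f.1 ≫ F = (θ A f).1 := by
  obtain ⟨F, hF⟩ := exists_hom_of_affine_points (X := X) (Y := Y)
    (fun R x => pointsMap θ x) (fun R R' q x => pointsMap_comp θ hθ q x)
  have hF' : ∀ {R : Type u} [CommRing R] [Algebra k R] (x : specAlg k R ⟶ X),
    x ≫ F = pointsMap θ x := fun x => hF (CommAlgCat.of k _) x
  refine ⟨F, hom_ext_affine fun R p => ?_, fun A f => ?_⟩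
  · have hp : p = CartesianMonoidalCategory.lift (p ≫ CartesianMonoidalCategory.fst _ _)
        (p ≫ CartesianMonoidalCategory.snd _ _) := by simp
    generalize p ≫ CartesianMonoidalCategory.fst _ _ = g at hp
    generalize p ≫ CartesianMonoidalCategory.snd _ _ = x at hp
    subst hp
    -- `F` carries the equivariant morphism `extend x` to a value of `θ`, which is again equivariant
    -- and so is the extension of its restriction `x ≫ F`. Evaluating at `(g, x)` through `comp_act`
    -- gives equivariance of `F`.
    have e : extend (H := H) x ≫ F = extend (x ≫ F) := by
      rw [hF' x]
      exact (hF' (extend (H := H) x)).trans <| (pointsMap_val θ hθ (EquivHom.ofPoint H x)).trans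
        (extend_unitSection_comp (θ _ (EquivHom.ofPoint H x)).2).symm
    rw [← Category.assoc, comp_act, Category.assoc, Category.assoc, e,
      CartesianMonoidalCategory.lift_whiskerLeft_assoc, comp_act]
  · rw [hF', pointsMap_val θ hθ]

/-- Descent of equivariant morphisms along a faithfully flat family. -/
lemma existsUnique_equivHom (hk : IsField k) {n : ℕ} {A : ComodAlg k H} (B : Fin n → ComodAlg k H)
    (f : ∀ i, A ⟶ B i) (hf : IsFaithfullyFlat (ComodAlg.piLift B f)) (x : ∀ i, EquivHom (B i) X)
    (hx : ∀ (i j : Fin n) (C : ComodAlg k H) (a : B i ⟶ C) (b : B j ⟶ C), f i ≫ a = f j ≫ b →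
      (x i).precomp a = (x j).precomp b) :
    ∃! t : EquivHom A X, ∀ i, t.precomp (f i) = x i := by
  have hmem := ofArrows_mem_overTopology (fun i => (f i).toAlgHom)
    (faithfullyFlat_of_isFaithfullyFlat hk _ hf)
  have hsh := isSheaf_yoneda_over X _ hmem
  rw [Sieve.ofArrows, ← Presieve.isSheafFor_iff_generate, Presieve.isSheafFor_arrows_iff] at hsh
  -- Ordinary descent needs agreement on all `k`-schemes over two members of the cover, but `hx`
  -- speaks only of comodule algebras. An affine point of `Z` gives algebra maps `a`, `b` to `R`;
  -- their lifts to `H ⊗ R` lie in `Alg C`, and the unit section recovers the point.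
  have hcompat : ∀ (i j : Fin n) (Z : Over (Spec k)) (gi : Z ⟶ specAlg k (B i).carrier)
      (gj : Z ⟶ specAlg k (B j).carrier),
      gi ≫ specMap (f i).toAlgHom = gj ≫ specMap (f j).toAlgHom → gi ≫ (x i).1 = gj ≫ (x j).1 := by
    intro i j Z gi gj h
    refine hom_ext_affine fun R z => ?_
    obtain ⟨a, ha⟩ := specMap_surjective (z ≫ gi)
    obtain ⟨b, hb⟩ := specMap_surjective (z ≫ gj)
    have hab : a.comp (f i).toAlgHom = b.comp (f j).toAlgHom := by
      have : specMap (a.comp (f i).toAlgHom) = specMap (b.comp (f j).toAlgHom) := by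
        rw [specMap_comp, specMap_comp, ha, hb, Category.assoc, Category.assoc, h]
      have := (algSpec k).map_injective this
      exact congrArg CommAlgCat.Hom.hom (congrArg Quiver.Hom.unop this)
    have key := congrArg (fun t => unitSection H R ≫ t.1) (hx i j _ (cofreeLift (B i) a)
      (cofreeLift (B j) b) (by rw [cofreeLift_comp, cofreeLift_comp, hab]))
    change unitSection H R ≫ specMap _ ≫ _ = unitSection H R ≫ specMap _ ≫ _ at key
    rw [← Category.assoc, ← Category.assoc, unitSection_comp_cofreeLift,
      unitSection_comp_cofreeLift, ha, hb, Category.assoc, Category.assoc] at key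
    exact key
  obtain ⟨t, ht, htu⟩ := hsh (fun i => (x i).1) (fun i j Z gi gj h => hcompat i j Z gi gj h)
  have ht' : ∀ i, specMap (f i).toAlgHom ≫ t = (x i).1 := ht
  -- Equivariance is an equality of morphisms out of `G × Spec A`, so it may be checked on the cover
  -- pulled back along the second projection, where `t` becomes the equivariant `x i`.
  have hequiv : Equivariant t := by
    refine hom_ext_of_mem ((overTopology k).pullback_stable
      (CartesianMonoidalCategory.snd (specAlg k H) (specAlg k A.carrier)) hmem) ?_
    rintro Z p ⟨_, q, _, ⟨i⟩, hq⟩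
    have hp : p = CartesianMonoidalCategory.lift (p ≫ CartesianMonoidalCategory.fst _ _) q ≫
        specAlg k H ◁ specMap (f i).toAlgHom := by
      ext1
      · simp
      · simpa using hq.symm
    rw [hp, Category.assoc, Category.assoc]
    congr 1
    rw [← Category.assoc, ← isModHom_spec (f i), Category.assoc, ← whiskerLeft_comp_assoc]
    refine (congrArg (actionMap (B i) ≫ ·) (ht' i)).trans ?_
    rw [ht' i]
    exact (x i).2
  refine ⟨⟨t, hequiv⟩, fun i => Subtype.ext (ht' i), fun s hs => Subtype.ext (htu s.1 fun i => ?_)⟩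
  exact congrArg Subtype.val (hs i)

end EquivariantPoints

end

end EquivGeom

namespace EquivGeom

noncomputable section

open MonoidalCategory Opposite MonObj

/-! ### From actions of `Spec O(G)` to actions of `G`. -/

section Transfer

variable {k : CommRingCat.{u}} {G : Scheme.{u}} [G.Over (Spec k)] [GrpObj (G.asOver (Spec k))]
  [IsAffine G]

/-- The action of `Spec O(G)` on a scheme with an action of `G`. -/
instance (X : GSch k G) : ModObj (specAlg k (CoordRing k G)) X.X :=
  Mod.scalarRestriction (isoSpecCoordRing k G).inv X.X

lemma act_eq (X : GSch k G) :
    act (H := CoordRing k G) X.X =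
      (isoSpecCoordRing k G).inv ▷ X.X ≫ (γ[G.asOver (Spec k), X.X] : _ ⊗ X.X ⟶ X.X) := rfl

lemma smul_eq (X : GSch k G) :
    (γ[G.asOver (Spec k), X.X] : G.asOver (Spec k) ⊗ X.X ⟶ X.X) =
      (isoSpecCoordRing k G).hom ▷ X.X ≫ act (H := CoordRing k G) X.X := by
  rw [act_eq, ← comp_whiskerRight_assoc, Iso.hom_inv_id, id_whiskerRight, Category.id_comp]

/-- Equivariance for `G` is equivariance for `Spec O(G)`. -/
lemma act_comp_iff {X Y : Over (Spec k)} (a : specAlg k (CoordRing k G) ⊗ X ⟶ X)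
    (b : specAlg k (CoordRing k G) ⊗ Y ⟶ Y) (f : X ⟶ Y) :
    ((isoSpecCoordRing k G).hom ▷ X ≫ a) ≫ f =
      G.asOver (Spec k) ◁ f ≫ (isoSpecCoordRing k G).hom ▷ Y ≫ b ↔
      a ≫ f = specAlg k (CoordRing k G) ◁ f ≫ b := by
  rw [← Category.assoc (_ ◁ _), whisker_exchange, Category.assoc, Category.assoc, cancel_epi]

lemma equivariant_hom {X : GSch k G} {A : ComodAlg k (CoordRing k G)}
    (f : (specG k G).obj (op A) ⟶ X) : Equivariant (X := X.X) (A := A) f.hom := by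
  have h := f.isModHom.smul_hom
  refine (act_comp_iff (G := G) (actionMap A) (act X.X) f.hom).1 ?_
  exact h.trans (congrArg (_ ◁ f.hom ≫ ·) (smul_eq X))

/-- The equivalence between morphisms of `G`-schemes and equivariant morphisms. -/
def specGHomEquiv (A : ComodAlg k (CoordRing k G)) (X : GSch k G) :
    ((specG k G).obj (op A) ⟶ X) ≃ EquivHom A X.X where
  toFun f := ⟨f.hom, equivariant_hom f⟩
  invFun f := Mod.Hom.mk' (M := (specG k G).obj (op A)) f.1
    (((act_comp_iff (G := G) (actionMap A) (act X.X) f.1).2 f.2).trans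
      (congrArg (_ ◁ f.1 ≫ ·) (smul_eq X).symm))
  left_inv _ := rfl
  right_inv _ := rfl

lemma isFaisceau_points (hk : IsField k) (X : GSch k G) :
    IsFaisceau ((pointsFunctor k G).obj X) := by
  rintro A _ ⟨n, B, f, hf, rfl⟩
  rw [Presieve.isSheafFor_arrows_iff]
  intro x hx
  obtain ⟨t, ht, htu⟩ := existsUnique_equivHom hk B f hf (fun i => specGHomEquiv (B i) X (x i))
    (fun i j C a b h => congrArg (specGHomEquiv C X)
      (hx i j (op C) a.op b.op (congrArg Quiver.Hom.op h)))
  refine ⟨(specGHomEquiv A.unop X).symm t, fun i => (specGHomEquiv (B i) X).injective (ht i),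
    fun s hs => (specGHomEquiv A.unop X).injective ?_⟩
  exact htu _ fun i => congrArg (specGHomEquiv (B i) X) (hs i)

instance faithful_points : (pointsFunctor k G).Faithful where
  map_injective {X Y F F'} h := by
    refine Mod.hom_ext _ _ (hom_ext_of_equivariant_points (H := CoordRing k G) fun A f => ?_)
    have := congrArg (fun t => t.app (op (op A))) h
    exact congrArg (fun t => (t ((specGHomEquiv A X).symm f)).hom) this

instance full_points : (pointsFunctor k G).Full where
  map_surjective {X Y} θ := by
    obtain ⟨F, hF, hFθ⟩ := exists_hom_of_equivariant_points (X := X.X) (Y := Y.X)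
      (fun A f => specGHomEquiv A Y (θ.app (op (op A)) ((specGHomEquiv A X).symm f)))
      (fun A B φ f => by
        have h := ConcreteCategory.congr_hom (θ.naturality φ.op.op) ((specGHomEquiv A X).symm f)
        exact congrArg (specGHomEquiv B Y) h)
    refine ⟨Mod.Hom.mk' F ?_, ?_⟩
    · have h := (act_comp_iff (G := G) (act X.X) (act Y.X) F).2 hF
      rw [← smul_eq, ← smul_eq] at h
      exact h
    · ext A f
      exact Mod.hom_ext _ _ (hFθ A.unop.unop (specGHomEquiv _ X f))

end Transfer

end

end EquivGeom

theorem theorem3 (k : CommRingCat.{u}) (hk : IsField k) (G : Scheme.{u}) [G.Over (Spec k)]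
    [GrpObj (G.asOver (Spec k))] [IsAffine G] :
    (∀ X : EquivGeom.GSch k G, EquivGeom.IsFaisceau ((EquivGeom.pointsFunctor k G).obj X)) ∧
      (EquivGeom.pointsFunctor k G).Full ∧ (EquivGeom.pointsFunctor k G).Faithful :=
  ⟨EquivGeom.isFaisceau_points hk, EquivGeom.full_points, EquivGeom.faithful_points⟩
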